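/- Let $\alpha\ge -1/2$, $1<p<\infty$, $1\le q\le\infty$, $p'=p/(p-1)$, and let $J_\alpha(x)=\sum_{k=0}^\infty \frac{(-1)^k}{k!\,\Gamma(k+\alpha+1)}\left(\frac x2\right)^{\alpha+2k}$ $(x>0)$ be the Bessel function of order $\alpha$. A function $f:(0,\infty)\to\mathbb C$ that is locally of bounded variation is called general monotone ($f\in GM$) with constants $C>0$ and $\lambda>1$ if $\int_x^{2x}|df(t)|\le C\int_{x/\lambda}^{\lambda x}\frac{|f(t)|}{t}\,dt$ for all $x>0$, where $\int_x^{2x}|df(t)|$ is the total variation of $f$ on $[x,2x]$. For a measurable function $f:(0,\infty)\to\mathbb C$ put $d_f(s)=|\{x>0:|f(x)|>s\}|$ (Lebesgue measure), $f^*(x)=\inf\{s>0:d_f(s)\le x\}$, and for $0<r<\infty$ put $\|f\|_{L^{r,q}}=\left(\int_0^\infty (x^{1/r}f^*(x))^q\frac{dx}{x}\right)^{1/q}$ if $q<\infty$ and $\|f\|_{L^{r,\infty}}=\sup_{x>0}x^{1/r}f^*(x)$; write $f\in L^{r,q}$ if $\|f\|_{L^{r,q}}<\infty$. The Hankel transform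 of $f$ is $H_\alpha f(y)=\lim_{M\to0+,\,N\to\infty}\int_M^N f(x)\sqrt{xy}\,J_\alpha(xy)\,dx$, $y>0$. Theorem. For all $C>0$ and $\lambda>1$ there is a constant $K$, depending only on $\alpha,p,q,C,\lambda$, such that for every $f\in GM$ with constants $C,\lambda$ and $f\in L^{p,q}$, the limit defining $H_\alpha f(y)$ exists for every $y>0$, $H_\alpha f\in L^{p',q}$, and $$\|H_\alpha f\|_{L^{p',q}}\le K\,\|f\|_{L^{p,q}}.$$ -/

import Mathlib

open MeasureTheory Set Filter Topology
open scoped ENNReal NNReal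

noncomputable section

/-- The Bessel function of the first kind `J_α(x) = ∑_{k ≥ 0} (-1)^k / (k! Γ(k+α+1)) (x/2)^(α+2k)`,
for `x > 0` and real order `α`. -/
def besselJ (α x : ℝ) : ℝ :=
  ∑' k : ℕ, (-1 : ℝ) ^ k / ((k.factorial : ℝ) * Real.Gamma (k + α + 1)) *
    (x / 2) ^ (α + 2 * (k : ℝ))

/-- `f`, viewed as a function on `(0,∞)`, is general monotone with constants `C` and `lam`:
it is locally of bounded variation and its total variation on `[x, 2x]` is at most
`C ∫_{x/lam}^{lam x} |f(t)|/t dt` for every `x > 0`. -/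
structure IsGeneralMonotone (C lam : ℝ) (f : ℝ → ℂ) : Prop where
  locallyBV : LocallyBoundedVariationOn f (Ioi 0)
  variation_le : ∀ x : ℝ, 0 < x →
    eVariationOn f (Icc x (2 * x)) ≤
      ENNReal.ofReal C * ∫⁻ t in Icc (x / lam) (lam * x), ‖f t‖ₑ / ENNReal.ofReal t

/-- The truncated Hankel integral `∫_M^N f(x) √(xy) J_α(xy) dx`. -/
def truncHankel (α : ℝ) (f : ℝ → ℂ) (y M N : ℝ) : ℂ :=
  ∫ x in M..N, f x * ((Real.sqrt (x * y) * besselJ α (x * y) : ℝ) : ℂ)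

/-- The truncated Hankel integrals at `y` converge to `l` as `M → 0+` and `N → ∞`
(independently of each other). -/
def HasHankelTransform (α : ℝ) (f : ℝ → ℂ) (y : ℝ) (l : ℂ) : Prop :=
  Tendsto (fun MN : ℝ × ℝ => truncHankel α f y MN.1 MN.2) (𝓝[>] (0 : ℝ) ×ˢ atTop) (𝓝 l)

/-- The Hankel transform `H_α f(y)`, as an improper integral. -/
def hankelTransform (α : ℝ) (f : ℝ → ℂ) (y : ℝ) : ℂ :=
  limUnder (𝓝[>] (0 : ℝ) ×ˢ atTop) (fun MN : ℝ × ℝ => truncHankel α f y MN.1 MN.2)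

/-- The distribution function `d_f(s) = |{x ∈ (0,∞) : |f(x)| > s}|`. -/
def distributionFun (f : ℝ → ℂ) (s : ℝ≥0∞) : ℝ≥0∞ :=
  volume {x : ℝ | 0 < x ∧ s < ‖f x‖ₑ}

/-- The decreasing rearrangement `f^*(x) = inf {s > 0 : d_f(s) ≤ x}`. -/
def decreasingRearrangement (f : ℝ → ℂ) (x : ℝ) : ℝ≥0∞ :=
  sInf {s : ℝ≥0∞ | 0 < s ∧ distributionFun f s ≤ ENNReal.ofReal x}

/-- The Lorentz functional `‖f‖_{L^{p,q}}` on `(0,∞)`, with values in `[0,∞]`,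
for `0 < p < ∞` and `0 < q ≤ ∞`. -/
def lorentzNorm (p : ℝ) (q : ℝ≥0∞) (f : ℝ → ℂ) : ℝ≥0∞ :=
  if q = ∞ then
    ⨆ x ∈ Ioi (0 : ℝ), ENNReal.ofReal (x ^ (1 / p)) * decreasingRearrangement f x
  else
    (∫⁻ x in Ioi (0 : ℝ),
      (ENNReal.ofReal (x ^ (1 / p)) * decreasingRearrangement f x) ^ q.toReal /
        ENNReal.ofReal x) ^ (1 / q.toReal)

/-- Membership of (the restriction to `(0,∞)` of) `f` in the Lorentz space `L^{p,q}`. -/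
def MemLorentz (p : ℝ) (q : ℝ≥0∞) (f : ℝ → ℂ) : Prop :=
  AEStronglyMeasurable f (volume.restrict (Ioi (0 : ℝ))) ∧ lorentzNorm p q f < ∞

end

/-!
The Hankel transform of a general monotone function is dominated pointwise by Hardy averages,
`|H_α f(y)| ≤ c (∫₀^{1/y} |f| + y⁻¹ ∫_{1/y}^∞ |f(t)| dt / t)`, and Hardy averages are bounded on
Lorentz spaces.

The pointwise bound (`exists_hasHankelTransform_le`) uses only two properties of the kernel
`φ(t) = √t J_α(t)`: it is bounded on `(0, ∞)`, and its integrals over subintervals of `[1, ∞)` are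
bounded. Both come from the equation `v'' = ((α² - 1/4) / t² - 1) v`, without asymptotic
expansions: the energy `v² + v'²` has logarithmic derivative of size `t⁻²`, hence stays bounded, and
`∫ v = -∫ v'' + (α² - 1/4) ∫ v / t²`. Over `(0, 1/y]` one then uses that `φ` is bounded; over
`[1/y, ∞)` one sums by parts (`norm_integral_mul_le_of_eVariationOn`), and the variation of `f` on
`[1/y, ∞)` is at most a multiple of `∫_{c/y}^∞ |f(t)| dt / t`, by general monotonicity on dyadic
blocks.

Both averages are combined in `hardySum |f| x = ∫₀^∞ min(1, x/t) |f(t)| dt` at `x = 1/y`. This is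
at most `hardySum f* x` (`hardySum_enorm_le`), because the weight is decreasing, and it is increasing
in `x`, so that the bound passes to `(H_α f)*(y)`. Finally `y^{1/p'} hardySum f* (1/y)` is a
superposition, with an integrable weight, of dilations of the reflection of `x^{1/p} f*(x)`. As
dilations preserve `dx / x`, Minkowski's inequality bounds its norm by that of `f`
(`haarLpNorm_hardySum_le`). The same estimate shows that `hardySum f*` is finite, which gives the
convergence of all integrals involved.
-/

/-! ### The power series of the Bessel function -/

/-- The coefficients of the entire function `z ↦ (√z)⁻ᵅ J_α(2√z)`. -/
noncomputable def besselCoeff (α : ℝ) (k : ℕ) : ℝ :=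
  (-1 : ℝ) ^ k / ((k.factorial : ℝ) * Real.Gamma (k + α + 1))

/-- The entire function `z ↦ ∑ (-1)^k z^k / (k! Γ(k+α+1))`, for which
`J_α(x) = (x/2)^α besselSeries α (x²/4)`. -/
noncomputable def besselSeries (α z : ℝ) : ℝ := ∑' k : ℕ, besselCoeff α k * z ^ k

theorem besselCoeff_succ (α : ℝ) (k : ℕ) :
    ((k : ℝ) + 1) * besselCoeff α (k + 1) = -besselCoeff (α + 1) k := by
  have h1 : (((k + 1 : ℕ) : ℝ) + α + 1) = (k : ℝ) + (α + 1) + 1 := by push_cast; ring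
  have h2 : ((k : ℝ) + 1) ≠ 0 := by positivity
  have h3 : (k.factorial : ℝ) ≠ 0 := by positivity
  unfold besselCoeff
  rw [h1, Nat.factorial_succ, pow_succ]
  push_cast
  rcases eq_or_ne (Real.Gamma ((k : ℝ) + (α + 1) + 1)) 0 with h | h
  · simp [h]
  · field_simp

theorem besselCoeff_eq {α : ℝ} (hα : -1 < α) (k : ℕ) :
    besselCoeff α k = (k + α + 1) * besselCoeff (α + 1) k := by
  have hk : (0 : ℝ) ≤ k := k.cast_nonneg
  have h0 : (k : ℝ) + α + 1 ≠ 0 := by linarith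
  have h2 : Real.Gamma ((k : ℝ) + (α + 1) + 1) = (k + α + 1) * Real.Gamma (k + α + 1) := by
    rw [← Real.Gamma_add_one h0]; ring_nf
  unfold besselCoeff
  rw [h2]
  have h3 : (k.factorial : ℝ) ≠ 0 := by positivity
  have h4 : Real.Gamma ((k : ℝ) + α + 1) ≠ 0 := (Real.Gamma_pos_of_pos (by linarith)).ne'
  field_simp

theorem summable_besselCoeff_mul_pow {α : ℝ} (hα : -1 < α) (z : ℝ) :
    Summable fun k => ‖besselCoeff α k * z ^ k‖ := by
  rcases eq_or_ne z 0 with rfl | hz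
  · refine summable_of_ne_finset_zero (s := {0}) fun k hk => ?_
    have : k ≠ 0 := by simpa using hk
    simp [this]
  have hne : ∀ k, besselCoeff α k ≠ 0 := fun k => by
    have hk : (0 : ℝ) ≤ k := k.cast_nonneg
    have h4 : Real.Gamma ((k : ℝ) + α + 1) ≠ 0 := (Real.Gamma_pos_of_pos (by linarith)).ne'
    unfold besselCoeff
    positivity
  refine summable_of_ratio_test_tendsto_lt_one (l := 0) one_pos
    (Eventually.of_forall fun k => ?_) ?_
  · simpa using ⟨hne k, fun h => absurd h hz⟩
  have hratio : ∀ k : ℕ, ‖‖besselCoeff α (k + 1) * z ^ (k + 1)‖‖ / ‖‖besselCoeff α k * z ^ k‖‖ =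
      |z| * (1 / ((k + 1 : ℝ) * (k + α + 1))) := fun k => by
    have hk : (0 : ℝ) ≤ k := k.cast_nonneg
    have h1 := besselCoeff_succ α k
    have h2 := besselCoeff_eq hα k
    have h0 : (0 : ℝ) < (k : ℝ) + α + 1 := by linarith
    have h3 : besselCoeff α (k + 1) = -(besselCoeff α k / ((k + 1) * (k + α + 1))) := by
      field_simp
      linear_combination (k + α + 1) * h1 + h2
    have h5 := hne k
    rw [h3, norm_norm, norm_norm, pow_succ]
    simp only [norm_mul, norm_neg, norm_div, Real.norm_eq_abs, abs_pow]
    rw [abs_of_pos h0, abs_of_pos (by positivity : (0 : ℝ) < k + 1)]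
    have h6 : |besselCoeff α k| ≠ 0 := abs_ne_zero.2 h5
    have h7 : |z| ≠ 0 := abs_ne_zero.2 hz
    field_simp
  simp only [hratio]
  have h1 : Tendsto (fun k : ℕ => (k + 1 : ℝ)) atTop atTop :=
    tendsto_atTop_add_const_right _ _ tendsto_natCast_atTop_atTop
  have h2 : Tendsto (fun k : ℕ => (k + α + 1 : ℝ)) atTop atTop :=
    tendsto_atTop_add_const_right _ _ (tendsto_atTop_add_const_right _ _ tendsto_natCast_atTop_atTop)
  simpa using (h1.atTop_mul_atTop₀ h2).inv_tendsto_atTop.const_mul |z|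

theorem hasDerivAt_besselSeries {α : ℝ} (hα : -1 < α) (z : ℝ) :
    HasDerivAt (besselSeries α) (-besselSeries (α + 1) z) z := by
  set R : ℝ := |z| + 1
  have hR : 0 ≤ R := by positivity
  have hs : Summable fun k : ℕ => |besselCoeff α k * (k * R ^ (k - 1))| := by
    rw [← summable_nat_add_iff 1]
    have := summable_besselCoeff_mul_pow (α := α + 1) (by linarith) R
    refine this.congr fun k => ?_
    rw [Real.norm_eq_abs, ← abs_neg, ← neg_mul, ← besselCoeff_succ]
    push_cast
    ring_nf
  have h := hasDerivAt_tsum_of_isPreconnected (t := Metric.ball (0 : ℝ) R) (y₀ := 0) (y := z)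
    (g := fun k z => besselCoeff α k * z ^ k)
    (g' := fun k z => besselCoeff α k * (k * z ^ (k - 1))) hs Metric.isOpen_ball
    (convex_ball _ _).isPreconnected
    (fun k x _ => (hasDerivAt_pow k x).const_mul _)
    (fun k x hx => by
      have hx' : |x| ≤ R := by simpa using (mem_ball_zero_iff.1 hx).le
      rw [Real.norm_eq_abs, abs_mul, abs_mul, abs_mul, abs_mul, abs_pow, abs_pow, abs_of_nonneg hR]
      gcongr)
    (by simp [R]; positivity) (summable_besselCoeff_mul_pow hα 0).of_norm
    (by simp [R])
  have h' : HasDerivAt (besselSeries α) _ z := h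
  convert h' using 1
  have hz : Summable fun k : ℕ => besselCoeff α k * (k * z ^ (k - 1)) := by
    refine Summable.of_norm (hs.of_nonneg_of_le (fun _ => norm_nonneg _) fun k => ?_)
    rw [Real.norm_eq_abs, abs_mul, abs_mul, abs_mul, abs_mul, abs_pow, abs_pow, abs_of_nonneg hR]
    gcongr
    simp [R]
  rw [besselSeries, ← tsum_neg, hz.tsum_eq_zero_add]
  simp only [Nat.cast_zero, zero_mul, mul_zero, zero_add]
  refine tsum_congr fun k => ?_
  rw [← neg_mul, ← besselCoeff_succ]
  push_cast
  ring

theorem continuous_besselSeries {α : ℝ} (hα : -1 < α) : Continuous (besselSeries α) :=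
  continuous_iff_continuousAt.2 fun z => (hasDerivAt_besselSeries hα z).continuousAt

theorem besselSeries_recurrence {α : ℝ} (hα : -1 < α) (z : ℝ) :
    z * besselSeries (α + 2) z - (α + 1) * besselSeries (α + 1) z + besselSeries α z = 0 := by
  have h2 : Summable fun k : ℕ => besselCoeff (α + 1) k * z ^ k :=
    (summable_besselCoeff_mul_pow (by linarith) z).of_norm
  have h3 : Summable fun k : ℕ => besselCoeff (α + 2) k * z ^ k :=
    (summable_besselCoeff_mul_pow (by linarith) z).of_norm
  have h4 : HasSum (fun k : ℕ => (k : ℝ) * besselCoeff (α + 1) k * z ^ k)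
      (-(z * besselSeries (α + 2) z)) := by
    rw [← hasSum_nat_add_iff' 1]
    simp only [Finset.range_one, Finset.sum_singleton, Nat.cast_zero, zero_mul, sub_zero]
    refine (h3.hasSum.mul_left z).neg.congr_fun fun k => ?_
    have := besselCoeff_succ (α + 1) k
    rw [show α + 1 + 1 = α + 2 by ring] at this
    push_cast
    rw [this]
    ring
  have h5 := h4.add (h2.hasSum.mul_left (α + 1))
  have h6 : besselSeries α z = -(z * besselSeries (α + 2) z) + (α + 1) * besselSeries (α + 1) z := by
    refine Eq.trans ?_ h5.tsum_eq
    · refine tsum_congr fun k => ?_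
      rw [besselCoeff_eq hα]
      ring
  rw [h6]
  ring

/-! ### The Bessel kernel and its differential equation -/

/-- The function `t^{α+1/2} besselSeries α (t²/4)`, which is `2^α √t J_α(t)` for `t > 0`. -/
noncomputable def besselKernel (α t : ℝ) : ℝ := t ^ (α + 1 / 2) * besselSeries α (t ^ 2 / 4)

theorem sqrt_mul_besselJ {α t : ℝ} (ht : 0 < t) :
    Real.sqrt t * besselJ α t = (1 / 2) ^ α * besselKernel α t := by
  have h : besselJ α t = (t / 2) ^ α * besselSeries α (t ^ 2 / 4) := by
    rw [besselJ, besselSeries, ← tsum_mul_left]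
    refine tsum_congr fun k => ?_
    have : (t / 2) ^ (2 * (k : ℝ)) = (t ^ 2 / 4) ^ k := by
      rw [Real.rpow_mul (by positivity), Real.rpow_natCast]
      norm_num
      ring
    rw [Real.rpow_add (by positivity), this, besselCoeff]
    ring
  rw [h, besselKernel, Real.sqrt_eq_rpow, Real.rpow_add ht, div_eq_mul_one_div t 2,
    Real.mul_rpow ht.le (by norm_num)]
  ac_rfl

/-- The derivative of `besselKernel α`. -/
noncomputable def besselKernelDeriv (α t : ℝ) : ℝ :=
  (α + 1 / 2) * t ^ (α - 1 / 2) * besselSeries α (t ^ 2 / 4) -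
    1 / 2 * (t ^ (α + 3 / 2) * besselSeries (α + 1) (t ^ 2 / 4))

theorem hasDerivAt_besselSeries_sq {α : ℝ} (hα : -1 < α) (t : ℝ) :
    HasDerivAt (fun t => besselSeries α (t ^ 2 / 4)) (-besselSeries (α + 1) (t ^ 2 / 4) * (t / 2)) t := by
  have h := (hasDerivAt_besselSeries hα (t ^ 2 / 4)).comp t ((hasDerivAt_pow 2 t).div_const 4)
  refine h.congr_deriv ?_
  simp only [Nat.cast_ofNat]
  ring

theorem hasDerivAt_besselKernel {α t : ℝ} (hα : -1 < α) (ht : 0 < t) :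
    HasDerivAt (besselKernel α) (besselKernelDeriv α t) t := by
  have h := (Real.hasDerivAt_rpow_const (p := α + 1 / 2) (Or.inl ht.ne')).mul
    (hasDerivAt_besselSeries_sq hα t)
  refine h.congr_deriv ?_
  rw [besselKernelDeriv, show α + 1 / 2 - 1 = α - 1 / 2 by ring,
    show α + 3 / 2 = α + 1 / 2 + 1 by ring, Real.rpow_add_one ht.ne']
  ring

/-- The Bessel equation in Liouville normal form. -/
theorem hasDerivAt_besselKernelDeriv {α t : ℝ} (hα : -1 < α) (ht : 0 < t) :
    HasDerivAt (besselKernelDeriv α) (((α ^ 2 - 1 / 4) / t ^ 2 - 1) * besselKernel α t) t := by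
  have h1 := ((Real.hasDerivAt_rpow_const (p := α - 1 / 2) (Or.inl ht.ne')).const_mul
    (α + 1 / 2)).mul (hasDerivAt_besselSeries_sq hα t)
  have h2 := ((Real.hasDerivAt_rpow_const (p := α + 3 / 2) (Or.inl ht.ne')).mul
    (hasDerivAt_besselSeries_sq (α := α + 1) (by linarith) t)).const_mul (1 / 2)
  refine (h1.sub h2).congr_deriv ?_
  have h3 := besselSeries_recurrence hα (t ^ 2 / 4)
  have e0 : t ^ (α + 1 / 2) = t ^ (α - 3 / 2) * t ^ 2 := by
    rw [← Real.rpow_add_natCast ht.ne']; congr 1; push_cast; ring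
  have e1 : t ^ (α - 1 / 2) = t ^ (α - 3 / 2) * t := by
    rw [← Real.rpow_add_one ht.ne']; congr 1; ring
  have e3 : t ^ (α + 3 / 2) = t ^ (α - 3 / 2) * t ^ 3 := by
    rw [← Real.rpow_add_natCast ht.ne']; congr 1; push_cast; ring
  rw [besselKernel, show α - 1 / 2 - 1 = α - 3 / 2 by ring,
    show α + 3 / 2 - 1 = α + 1 / 2 by ring, e0, e1, e3, show α + 1 + 1 = α + 2 by ring]
  field_simp
  linear_combination (16 * t ^ 2 : ℝ) * h3

theorem continuousOn_besselKernel {α : ℝ} (hα : -1 < α) :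
    ContinuousOn (besselKernel α) (Ioi 0) := fun _ ht =>
  (hasDerivAt_besselKernel hα ht).continuousAt.continuousWithinAt

/-! ### Boundedness and oscillation of the Bessel kernel -/

/-- The energy `v² + v'²` of the solution `v` of `v'' = (c / t² - 1) v`,
`c = α² - 1/4`, stays bounded on `[1, ∞)`, as its logarithmic derivative is at most `|c| / t²`. -/
theorem exists_besselKernel_energy_le {α : ℝ} (hα : -1 < α) :
    ∃ S, 0 ≤ S ∧ ∀ t, 1 ≤ t → |besselKernel α t| ≤ S ∧ |besselKernelDeriv α t| ≤ S := by
  set c : ℝ := α ^ 2 - 1 / 4 with hc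
  set v := besselKernel α
  set w := besselKernelDeriv α
  set F : ℝ → ℝ := fun t => (v t ^ 2 + w t ^ 2) * Real.exp (|c| * t⁻¹) with hF
  have hd : ∀ t, 0 < t → HasDerivAt F
      ((2 * v t * w t + 2 * w t * ((c / t ^ 2 - 1) * v t)) * Real.exp (|c| * t⁻¹) +
        (v t ^ 2 + w t ^ 2) * (Real.exp (|c| * t⁻¹) * (|c| * -(t ^ 2)⁻¹))) t := fun t ht => by
    have h1 := ((hasDerivAt_besselKernel hα ht).pow 2).add
      ((hasDerivAt_besselKernelDeriv hα ht).pow 2)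
    have h2 := ((hasDerivAt_inv ht.ne').const_mul |c|).exp
    refine (h1.mul h2).congr_deriv ?_
    simp only [v, w, hc, Pi.add_apply, Pi.pow_apply]
    push_cast
    ring
  have hanti : AntitoneOn F (Ici 1) := by
    refine antitoneOn_of_deriv_nonpos (convex_Ici 1)
      (fun t ht => (hd t (zero_lt_one.trans_le ht)).continuousAt.continuousWithinAt)
      (fun t ht => ?_) (fun t ht => ?_)
    · rw [interior_Ici] at ht
      exact (hd t (zero_lt_one.trans ht)).differentiableAt.differentiableWithinAt
    · rw [interior_Ici] at ht
      have ht0 : (0 : ℝ) < t := zero_lt_one.trans ht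
      rw [(hd t ht0).deriv]
      have h1 : 2 * w t * v t * c ≤ (v t ^ 2 + w t ^ 2) * |c| := by
        refine (le_abs_self _).trans ?_
        rw [abs_mul]
        gcongr
        rw [abs_le]
        constructor <;> nlinarith [sq_nonneg (v t + w t), sq_nonneg (v t - w t)]
      have h2 : (2 * v t * w t + 2 * w t * ((c / t ^ 2 - 1) * v t)) * Real.exp (|c| * t⁻¹) +
        (v t ^ 2 + w t ^ 2) * (Real.exp (|c| * t⁻¹) * (|c| * -(t ^ 2)⁻¹)) =
        (Real.exp (|c| * t⁻¹) * (t ^ 2)⁻¹) *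
          (2 * w t * v t * c - (v t ^ 2 + w t ^ 2) * |c|) := by
        ring
      rw [h2]
      exact mul_nonpos_of_nonneg_of_nonpos (by positivity) (by linarith)
  refine ⟨Real.sqrt (F 1), Real.sqrt_nonneg _, fun t ht => ?_⟩
  have h1 : v t ^ 2 + w t ^ 2 ≤ F 1 := by
    refine le_trans ?_ (hanti (by simp) ht ht)
    refine le_mul_of_one_le_right (by positivity) (Real.one_le_exp ?_)
    have : 0 < t := by linarith
    positivity
  exact ⟨Real.abs_le_sqrt (by nlinarith [sq_nonneg (w t)]),
    Real.abs_le_sqrt (by nlinarith [sq_nonneg (v t)])⟩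

theorem exists_abs_besselKernel_le {α : ℝ} (hα : -1 / 2 ≤ α) :
    ∃ A, 0 ≤ A ∧ ∀ t, 0 < t → |besselKernel α t| ≤ A := by
  have hα' : -1 < α := by linarith
  obtain ⟨S, hS0, hS⟩ := exists_besselKernel_energy_le hα'
  obtain ⟨D, hD⟩ := (isCompact_Icc (a := (0 : ℝ)) (b := 1)).exists_bound_of_continuousOn
    (f := fun t => besselSeries α (t ^ 2 / 4))
    ((continuous_besselSeries hα').comp (by fun_prop)).continuousOn
  refine ⟨max S D, le_max_of_le_left hS0, fun t ht => ?_⟩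
  rcases le_total 1 t with h | h
  · exact (hS t h).1.trans (le_max_left _ _)
  · refine le_trans ?_ (le_max_right _ _)
    rw [besselKernel, abs_mul, abs_of_pos (by positivity)]
    have h1 : |besselSeries α (t ^ 2 / 4)| ≤ D := hD t ⟨ht.le, h⟩
    exact (mul_le_of_le_one_left (abs_nonneg _)
      (Real.rpow_le_one ht.le h (by linarith))).trans h1

/-- The integrals of the kernel over subintervals of `[1, ∞)` are bounded: by the differential
equation, `v = -v'' + c v / t²`, where the first term has bounded primitive and the second
is integrable. -/
theorem exists_abs_integral_besselKernel_le {α : ℝ} (hα : -1 / 2 ≤ α) :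
    ∃ B, 0 ≤ B ∧ ∀ a b, 1 ≤ a → a ≤ b → |∫ t in a..b, besselKernel α t| ≤ B := by
  have hα' : -1 < α := by linarith
  obtain ⟨S, hS0, hS⟩ := exists_besselKernel_energy_le hα'
  set c : ℝ := α ^ 2 - 1 / 4 with hc
  refine ⟨2 * S + |c| * S, by positivity, fun a b ha hab => ?_⟩
  have hpos : ∀ t ∈ uIcc a b, 0 < t := fun t ht => by
    rw [uIcc_of_le hab] at ht; linarith [ht.1]
  have hcont : ContinuousOn (besselKernel α) (uIcc a b) := (continuousOn_besselKernel hα').mono hpos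
  have hinv : ContinuousOn (fun t : ℝ => (t ^ 2)⁻¹) (uIcc a b) :=
    ContinuousOn.inv₀ (by fun_prop) fun t ht => (pow_pos (hpos t ht) 2).ne'
  have hint1 : IntervalIntegrable (fun t => (t ^ 2)⁻¹ * besselKernel α t) volume a b :=
    (hinv.mul hcont).intervalIntegrable
  have h1 : ∫ t in a..b, ((α ^ 2 - 1 / 4) / t ^ 2 - 1) * besselKernel α t =
      besselKernelDeriv α b - besselKernelDeriv α a := by
    refine intervalIntegral.integral_eq_sub_of_hasDerivAt
      (fun t ht => hasDerivAt_besselKernelDeriv hα' (hpos t ht)) ?_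
    refine ((hint1.const_mul c).sub hcont.intervalIntegrable).congr fun t _ => ?_
    simp only [hc]
    ring
  have h2 : ∫ t in a..b, besselKernel α t =
      c * (∫ t in a..b, (t ^ 2)⁻¹ * besselKernel α t) -
        (besselKernelDeriv α b - besselKernelDeriv α a) := by
    rw [← h1, ← intervalIntegral.integral_const_mul, ← intervalIntegral.integral_sub
      (hint1.const_mul c)]
    · congr 1; ext t; simp only [hc]; ring
    · refine ((hint1.const_mul c).sub hcont.intervalIntegrable).congr fun t _ => ?_
      simp only [hc]
      ring
  have h3 : |∫ t in a..b, (t ^ 2)⁻¹ * besselKernel α t| ≤ S := by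
    have h4 : ∫ t in a..b, (t ^ 2)⁻¹ * S = (a⁻¹ - b⁻¹) * S := by
      rw [intervalIntegral.integral_mul_const]
      congr 1
      rw [intervalIntegral.integral_eq_sub_of_hasDerivAt (f := fun t => -t⁻¹)
        (fun t ht => (hasDerivAt_inv (hpos t ht).ne').neg.congr_deriv (neg_neg _)) hinv.intervalIntegrable]
      ring
    have h5 : ‖∫ t in a..b, (t ^ 2)⁻¹ * besselKernel α t‖ ≤ ∫ t in a..b, (t ^ 2)⁻¹ * S := by
      refine intervalIntegral.norm_integral_le_of_norm_le hab
        (Eventually.of_forall fun t ht => ?_) (hinv.intervalIntegrable.mul_const S)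
      rw [norm_mul, Real.norm_eq_abs, Real.norm_eq_abs, abs_of_nonneg (by positivity)]
      gcongr
      exact (hS t (ha.trans ht.1.le)).1
    rw [h4] at h5
    refine h5.trans (mul_le_of_le_one_left hS0 ?_)
    have h6 : a⁻¹ ≤ 1 := inv_le_one_of_one_le₀ ha
    have h7 : 0 ≤ b⁻¹ := by have : 0 < b := by linarith
                            positivity
    linarith
  rw [h2]
  have h8 := (hS a ha).2
  have h9 := (hS b (ha.trans hab)).2
  calc _ ≤ |c * (∫ t in a..b, (t ^ 2)⁻¹ * besselKernel α t)| +
        |besselKernelDeriv α b - besselKernelDeriv α a| := abs_sub _ _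
    _ ≤ |c| * S + (S + S) := by
        rw [abs_mul]
        gcongr
        exact (abs_sub _ _).trans (add_le_add h9 h8)
    _ = _ := by ring

/-! ### Integration against a function of bounded variation -/

theorem edist_le_eVariationOn_Icc (f : ℝ → ℂ) {x y t : ℝ} (ht : t ∈ Icc x y) :
    edist (f t) (f y) ≤ eVariationOn f (Icc x y) :=
  eVariationOn.edist_le f ht (right_mem_Icc.2 (ht.1.trans ht.2))

/-- One step of the comparison of `∫ f ψ` with the primitive of `ψ`: over a short interval `[c, d]`,
`∫ f ψ - f P` changes by at most `(B + A (d - c))` times the variation of `f`. -/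
theorem norm_integral_mul_sub_step_le {f : ℝ → ℂ} {ψ : ℝ → ℝ} {a c d A B : ℝ}
    (hac : a ≤ c) (hcd : c ≤ d) (hV : eVariationOn f (Icc c d) ≠ ∞)
    (hf : IntervalIntegrable f volume a d) (hψ : ContinuousOn ψ (Icc a d))
    (hA : ∀ t ∈ Icc c d, |ψ t| ≤ A) (hB : |∫ t in a..c, ψ t| ≤ B) :
    ‖((∫ t in a..d, f t * (ψ t : ℂ)) - f d * ((∫ t in a..d, ψ t : ℝ) : ℂ)) -
      ((∫ t in a..c, f t * (ψ t : ℂ)) - f c * ((∫ t in a..c, ψ t : ℝ) : ℂ))‖ ≤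
    (B + A * (d - c)) * (eVariationOn f (Icc c d)).toReal := by
  set V := (eVariationOn f (Icc c d)).toReal
  have had := hac.trans hcd
  have hψ' : ContinuousOn (fun t => (ψ t : ℂ)) (uIcc a d) := by
    rw [uIcc_of_le had]; exact Complex.continuous_ofReal.comp_continuousOn hψ
  have hi := hf.mul_continuousOn hψ'
  have hs1 : uIcc a c ⊆ uIcc a d := by
    rw [uIcc_of_le hac, uIcc_of_le had]; exact Icc_subset_Icc_right hcd
  have hs2 : uIcc c d ⊆ uIcc a d := by
    rw [uIcc_of_le hcd, uIcc_of_le had]; exact Icc_subset_Icc_left hac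
  have hψi : IntervalIntegrable ψ volume a d :=
    ContinuousOn.intervalIntegrable (by rwa [uIcc_of_le had])
  have hψc : IntervalIntegrable (fun t => (ψ t : ℂ)) volume c d := (hψ'.mono hs2).intervalIntegrable
  have e1 := intervalIntegral.integral_add_adjacent_intervals (hi.mono_set hs1) (hi.mono_set hs2)
  have e2 := intervalIntegral.integral_add_adjacent_intervals (hψi.mono_set hs1) (hψi.mono_set hs2)
  have e3 : ∫ t in c..d, (f t - f d) * (ψ t : ℂ) =
      (∫ t in c..d, f t * (ψ t : ℂ)) - f d * ((∫ t in c..d, ψ t : ℝ) : ℂ) := by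
    rw [← intervalIntegral.integral_ofReal, ← intervalIntegral.integral_const_mul,
      ← intervalIntegral.integral_sub (hi.mono_set hs2) (hψc.const_mul _)]
    simp only [sub_mul]
  have key : ((∫ t in a..d, f t * (ψ t : ℂ)) - f d * ((∫ t in a..d, ψ t : ℝ) : ℂ)) -
      ((∫ t in a..c, f t * (ψ t : ℂ)) - f c * ((∫ t in a..c, ψ t : ℝ) : ℂ)) =
      (∫ t in c..d, (f t - f d) * (ψ t : ℂ)) + (f c - f d) * ((∫ t in a..c, ψ t : ℝ) : ℂ) := by
    rw [e3, ← e1, ← e2]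
    push_cast
    ring
  have hfV : ∀ t ∈ Icc c d, ‖f t - f d‖ ≤ V := fun t ht => by
    rw [← dist_eq_norm, dist_edist]
    exact ENNReal.toReal_mono hV (edist_le_eVariationOn_Icc f ht)
  have h1 : ‖∫ t in c..d, (f t - f d) * (ψ t : ℂ)‖ ≤ V * A * |d - c| := by
    refine intervalIntegral.norm_integral_le_of_norm_le_const fun t ht => ?_
    rw [uIoc_of_le hcd] at ht
    have ht' : t ∈ Icc c d := ⟨ht.1.le, ht.2⟩
    rw [norm_mul, Complex.norm_real, Real.norm_eq_abs]
    exact mul_le_mul (hfV t ht') (hA t ht') (abs_nonneg _) ENNReal.toReal_nonneg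
  have h2 : ‖(f c - f d) * ((∫ t in a..c, ψ t : ℝ) : ℂ)‖ ≤ V * B := by
    rw [norm_mul, Complex.norm_real, Real.norm_eq_abs]
    exact mul_le_mul (hfV c (left_mem_Icc.2 hcd)) hB (abs_nonneg _) ENNReal.toReal_nonneg
  rw [abs_of_nonneg (sub_nonneg.2 hcd)] at h1
  rw [key]
  linarith [norm_add_le (∫ t in c..d, (f t - f d) * (ψ t : ℂ))
    ((f c - f d) * ((∫ t in a..c, ψ t : ℝ) : ℂ))]

/-- Summation by parts for a function of bounded variation: if the primitive of `ψ` that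
vanishes at `a` is bounded by `B`, then `∫ f ψ` is at most `B (|f b| + Var f)`. -/
theorem norm_integral_mul_le_of_eVariationOn {f : ℝ → ℂ} {ψ : ℝ → ℝ} {a b B : ℝ}
    (hab : a ≤ b) (hV : eVariationOn f (Icc a b) ≠ ∞)
    (hf : IntervalIntegrable f volume a b) (hψ : ContinuousOn ψ (Icc a b))
    (hB : ∀ c ∈ Icc a b, |∫ t in a..c, ψ t| ≤ B) :
    ‖∫ t in a..b, f t * (ψ t : ℂ)‖ ≤ B * (‖f b‖ + (eVariationOn f (Icc a b)).toReal) := by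
  obtain ⟨A, hA⟩ := isCompact_Icc.exists_bound_of_continuousOn hψ
  set V := (eVariationOn f (Icc a b)).toReal
  set D : ℝ → ℂ := fun x => (∫ t in a..x, f t * (ψ t : ℂ)) - f x * ((∫ t in a..x, ψ t : ℝ) : ℂ)
    with hD
  -- Add the one-step estimate over `n + 1` equal subintervals; the term with `A` vanishes in
  -- the limit.
  have hpart : ∀ n : ℕ, ‖D b‖ ≤ (B + A * ((b - a) / (n + 1))) * V := fun n => by
    set h : ℝ := (b - a) / (n + 1) with hh
    have hh0 : 0 ≤ h := div_nonneg (sub_nonneg.2 hab) (by positivity)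
    have hn : a + (n + 1) * h = b := by rw [hh]; field_simp; ring
    have hind : ∀ m : ℕ, m ≤ n + 1 →
        ‖D (a + m * h)‖ ≤ (B + A * h) * (eVariationOn f (Icc a (a + m * h))).toReal := by
      intro m
      induction m with
      | zero => intro _; simp [hD]
      | succ m ih =>
        intro hm
        have hc : a ≤ a + m * h := by have : 0 ≤ m * h := by positivity
                                      linarith
        have hcd : a + m * h ≤ a + (m + 1 : ℕ) * h := by push_cast; linarith
        have hdb : a + (m + 1 : ℕ) * h ≤ b := by
          rw [← hn]
          have : ((m + 1 : ℕ) : ℝ) ≤ n + 1 := by exact_mod_cast hm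
          gcongr
        set c := a + m * h with hcdef
        set d := a + (m + 1 : ℕ) * h with hddef
        have hVm : ∀ x y, a ≤ x → y ≤ b → eVariationOn f (Icc x y) ≠ ∞ := fun x y hx hy =>
          ne_top_of_le_ne_top hV (eVariationOn.mono f (Icc_subset_Icc hx hy))
        have hstep := norm_integral_mul_sub_step_le (A := A) (B := B) hc hcd (hVm c d hc hdb)
          (hf.mono_set (by
            rw [uIcc_of_le hab, uIcc_of_le (hc.trans hcd)]; exact Icc_subset_Icc_right hdb))
          (hψ.mono (Icc_subset_Icc_right hdb))
          (fun t ht => hA t ⟨hc.trans ht.1, ht.2.trans hdb⟩) (hB c ⟨hc, hcd.trans hdb⟩)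
        have hdc : d - c = h := by rw [hddef, hcdef]; push_cast; ring
        rw [hdc] at hstep
        have hadd := eVariationOn.Icc_add_Icc f (s := univ) hc hcd (mem_univ _)
        simp only [univ_inter] at hadd
        rw [← hadd, ENNReal.toReal_add (hVm _ _ le_rfl (hcd.trans hdb)) (hVm _ _ hc hdb)]
        have := ih (by omega)
        have h3 : ‖D d‖ ≤ ‖D d - D c‖ + ‖D c‖ := by
          simpa using norm_add_le (D d - D c) (D c)
        have h4 : ‖D d - D c‖ ≤ (B + A * h) * (eVariationOn f (Icc c d)).toReal := hstep
        linarith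
    have := hind (n + 1) le_rfl
    push_cast at this
    rwa [hn] at this
  have hlim : Tendsto (fun n : ℕ => (B + A * ((b - a) / ((n : ℝ) + 1))) * V) atTop
      (𝓝 ((B + A * 0) * V)) := by
    refine ((Tendsto.const_mul A ?_).const_add B).mul_const V
    simpa [div_eq_mul_inv] using
      (tendsto_one_div_add_atTop_nhds_zero_nat (𝕜 := ℝ)).const_mul (b - a)
  have hDb : ‖D b‖ ≤ (B + A * 0) * V := ge_of_tendsto' hlim hpart
  have h1 : ‖f b * ((∫ t in a..b, ψ t : ℝ) : ℂ)‖ ≤ ‖f b‖ * B := by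
    rw [norm_mul, Complex.norm_real, Real.norm_eq_abs]
    gcongr
    exact hB b (right_mem_Icc.2 hab)
  have h2 : ∫ t in a..b, f t * (ψ t : ℂ) = D b + f b * ((∫ t in a..b, ψ t : ℝ) : ℂ) := by
    simp [hD]
  rw [h2]
  linarith [norm_add_le (D b) (f b * ((∫ t in a..b, ψ t : ℝ) : ℂ))]

/-! ### Variation of general monotone functions at infinity -/

/-- In the sequence of intervals `(I k, I (k + N)]` every point is covered at most `N` times. -/
theorem sum_measure_Ioc_le (μ : Measure ℝ) {I : ℕ → ℝ} (hI : Monotone I) (N n : ℕ) :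
    ∑ k ∈ Finset.range n, μ (Ioc (I k) (I (k + N))) ≤ N * μ (Ioi (I 0)) := by
  induction N with
  | zero => simp
  | succ N ih =>
    have h1 : ∀ k, μ (Ioc (I k) (I (k + (N + 1)))) ≤
        μ (Ioc (I k) (I (k + N))) + μ (Ioc (I (k + N)) (I (k + N + 1))) := fun k =>
      (measure_mono Ioc_subset_Ioc_union_Ioc).trans (measure_union_le _ _)
    have h2 : ∑ k ∈ Finset.range n, μ (Ioc (I (k + N)) (I (k + N + 1))) ≤ μ (Ioi (I 0)) := by
      have hd := hI.pairwise_disjoint_on_Ioc_succ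
      rw [← measure_biUnion_finset]
      · refine measure_mono (iUnion₂_subset fun k _ x hx => ?_)
        exact lt_of_le_of_lt (hI (Nat.zero_le _)) hx.1
      · intro i _ j _ hij
        exact hd (fun h => hij (by omega))
      · exact fun _ _ => measurableSet_Ioc
    calc _ ≤ ∑ k ∈ Finset.range n,
          (μ (Ioc (I k) (I (k + N))) + μ (Ioc (I (k + N)) (I (k + N + 1)))) :=
          Finset.sum_le_sum fun k _ => h1 k
      _ ≤ N * μ (Ioi (I 0)) + μ (Ioi (I 0)) := by
          rw [Finset.sum_add_distrib]; exact add_le_add ih h2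
      _ = _ := by push_cast; ring

/-- The variation of a general monotone function at infinity is controlled by the
tail of `∫ |f(t)| dt / t`. -/
theorem IsGeneralMonotone.eVariationOn_Ici_le {C lam : ℝ} {f : ℝ → ℂ}
    (hf : IsGeneralMonotone C lam f) (hlam : 1 < lam) {m : ℕ} (hm : lam ≤ 2 ^ m) {a : ℝ}
    (ha : 0 < a) :
    eVariationOn f (Ici a) ≤ ENNReal.ofReal C *
      ((2 * m : ℕ) * ∫⁻ t in Ioi (a / 2 ^ m), ‖f t‖ₑ / ENNReal.ofReal t) := by
  -- With `b = a / 2 ^ m`, the `k`-th dyadic block `[2^k a, 2^(k+1) a]` is controlled by the integral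
  -- over `(2^k b, 2^(k+2m) b]`, and these intervals overlap at most `2 m` times.
  set μ : Measure ℝ := volume.withDensity fun t => ‖f t‖ₑ / ENNReal.ofReal t
  set I : ℕ → ℝ := fun k => 2 ^ k * (a / 2 ^ m) with hI
  have hmono : Monotone I := fun i j hij => by
    simp only [hI]
    gcongr
    norm_num
  have hJ : Monotone fun k : ℕ => (2 : ℝ) ^ k * a := fun i j hij => by
    simp only
    gcongr
    norm_num
  have hpiece : ∀ k : ℕ, eVariationOn f (Icc (2 ^ k * a) (2 ^ (k + 1) * a)) ≤
      ENNReal.ofReal C * μ (Ioc (I k) (I (k + 2 * m))) := fun k => by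
    have hlam0 : 0 < lam := by linarith
    have h := hf.variation_le (2 ^ k * a) (by positivity)
    rw [show 2 * (2 ^ k * a) = 2 ^ (k + 1) * a by ring] at h
    refine h.trans ?_
    gcongr
    rw [withDensity_apply _ measurableSet_Ioc, ← setLIntegral_congr (Ioc_ae_eq_Icc)]
    refine lintegral_mono_set (Ioc_subset_Ioc ?_ ?_)
    · simp only [hI]
      rw [← mul_div_assoc]
      gcongr
    · have e : I (k + 2 * m) = 2 ^ m * (2 ^ k * a) := by
        simp only [hI]
        rw [pow_add, pow_mul', sq]
        field_simp
      rw [e]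
      gcongr
  have hfin : ∀ n : ℕ, eVariationOn f (Icc a (2 ^ n * a)) ≤
      ENNReal.ofReal C * ((2 * m : ℕ) * ∫⁻ t in Ioi (a / 2 ^ m), ‖f t‖ₑ / ENNReal.ofReal t) :=
    fun n => by
    have h := eVariationOn.sum' f hJ (n := n)
    simp only [pow_zero, one_mul] at h
    rw [← h]
    refine (Finset.sum_le_sum fun k _ => hpiece k).trans ?_
    rw [← Finset.mul_sum]
    gcongr
    refine (sum_measure_Ioc_le μ hmono (2 * m) n).trans (le_of_eq ?_)
    rw [withDensity_apply _ measurableSet_Ioi]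
    simp [hI]
  rw [eVariationOn.eq_biSup_inter_Icc]
  refine iSup_le fun p => iSup_le fun hp => ?_
  obtain ⟨n, hn⟩ := pow_unbounded_of_one_lt (p.2 / a) (one_lt_two (α := ℝ))
  refine (eVariationOn.mono f fun t ht => ?_).trans (hfin n)
  exact ⟨ht.1, ht.2.2.trans (by rw [div_lt_iff₀ ha] at hn; exact hn.le)⟩

theorem lintegral_Ioi_inv_eq_top (b : ℝ) :
    ∫⁻ t in Ioi b, (ENNReal.ofReal t)⁻¹ = ∞ := by
  by_contra h
  refine not_integrableOn_Ioi_inv (a := max b 0) ⟨by fun_prop, ?_⟩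
  refine lt_of_le_of_lt ?_ (lt_top_iff_ne_top.2 h)
  refine le_trans (le_of_eq ?_) (lintegral_mono_set (Ioi_subset_Ioi (le_max_left b 0)))
  refine setLIntegral_congr_fun measurableSet_Ioi fun t ht => ?_
  have ht0 : 0 < t := (le_max_right b 0).trans_lt ht
  simp only
  rw [← ENNReal.ofReal_inv_of_pos ht0, Real.enorm_eq_ofReal (inv_nonneg.2 ht0.le)]

/-- A function whose average against `dt / t` is finite at infinity cannot stay away from `0`,
so it is bounded by its variation on the half-line. -/
theorem enorm_le_eVariationOn_Ici {f : ℝ → ℂ} {b : ℝ}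
    (hf : ∫⁻ t in Ioi b, ‖f t‖ₑ / ENNReal.ofReal t ≠ ∞) :
    ‖f b‖ₑ ≤ eVariationOn f (Ici b) := by
  by_contra! hlt
  set δ := ‖f b‖ₑ - eVariationOn f (Ici b)
  have hδ : δ ≠ 0 := (tsub_pos_of_lt hlt).ne'
  have h1 : ∀ t ∈ Ioi b, δ * (ENNReal.ofReal t)⁻¹ ≤ ‖f t‖ₑ / ENNReal.ofReal t := fun t ht => by
    rw [div_eq_mul_inv]
    gcongr
    rw [tsub_le_iff_left]
    calc ‖f b‖ₑ ≤ ‖f b - f t‖ₑ + ‖f t‖ₑ := by simpa using enorm_add_le (f b - f t) (f t)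
      _ ≤ _ := by
        rw [← edist_eq_enorm_sub]
        gcongr
        exact eVariationOn.edist_le f self_mem_Ici (mem_Ici.2 (le_of_lt ht))
  refine hf (top_le_iff.1 ?_)
  calc ∞ = δ * ∫⁻ t in Ioi b, (ENNReal.ofReal t)⁻¹ := by
        rw [lintegral_Ioi_inv_eq_top, ENNReal.mul_top hδ]
    _ = ∫⁻ t in Ioi b, δ * (ENNReal.ofReal t)⁻¹ := by
        rw [lintegral_const_mul _ (by fun_prop)]
    _ ≤ _ := setLIntegral_mono' measurableSet_Ioi h1

/-! ### The layer cake formula -/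

theorem volume_Ioi_inter_ofReal_le (a : ℝ≥0∞) :
    volume (Ioi (0 : ℝ) ∩ {s | ENNReal.ofReal s ≤ a}) = a := by
  rcases eq_or_ne a ∞ with rfl | ha
  · simp
  · have : Ioi (0 : ℝ) ∩ {s | ENNReal.ofReal s ≤ a} = Ioc 0 a.toReal := by
      ext s
      simp [ENNReal.ofReal_le_iff_le_toReal ha]
    rw [this, Real.volume_Ioc, sub_zero, ENNReal.ofReal_toReal ha]

/-- The layer cake formula for extended nonnegative functions, with a weight. -/
theorem lintegral_mul_eq_lintegral_superlevel {μ : Measure ℝ} [SFinite μ] {w u : ℝ → ℝ≥0∞}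
    (hw : Measurable w) (hu : AEMeasurable u μ) :
    ∫⁻ t, w t * u t ∂μ =
      ∫⁻ s in Ioi (0 : ℝ), ∫⁻ t in {t | ENNReal.ofReal s ≤ w t}, u t ∂μ := by
  have hS : MeasurableSet {q : ℝ × ℝ | ENNReal.ofReal q.2 ≤ w q.1} :=
    measurableSet_le (by fun_prop) (hw.comp measurable_fst)
  have h1 : ∀ t, w t * u t = ∫⁻ s in Ioi (0 : ℝ),
      {q : ℝ × ℝ | ENNReal.ofReal q.2 ≤ w q.1}.indicator (fun q => u q.1) (t, s) := fun t => by
    have e : ∀ s, {q : ℝ × ℝ | ENNReal.ofReal q.2 ≤ w q.1}.indicator (fun q => u q.1) (t, s) =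
        {s | ENNReal.ofReal s ≤ w t}.indicator (fun _ => u t) s := fun s => by
      simp [indicator]
    have hm : MeasurableSet {s | ENNReal.ofReal s ≤ w t} :=
      measurableSet_le (by fun_prop) measurable_const
    simp only [e]
    rw [lintegral_indicator hm, setLIntegral_const, Measure.restrict_apply hm, inter_comm,
      volume_Ioi_inter_ofReal_le, mul_comm]
  simp only [h1]
  rw [lintegral_lintegral_swap]
  · refine lintegral_congr fun s => ?_
    have hm : MeasurableSet {t | ENNReal.ofReal s ≤ w t} := measurableSet_le measurable_const hw
    rw [← lintegral_indicator hm]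
    refine lintegral_congr fun t => ?_
    simp [indicator]
  · exact (hu.comp_fst).indicator hS

/-! ### Decreasing rearrangements -/

theorem distributionFun_anti (f : ℝ → ℂ) : Antitone (distributionFun f) := fun _ _ h =>
  measure_mono fun _ ht => ⟨ht.1, h.trans_lt ht.2⟩

theorem decreasingRearrangement_anti (f : ℝ → ℂ) : Antitone (decreasingRearrangement f) :=
  fun _ _ h => sInf_le_sInf fun _ hs => ⟨hs.1, hs.2.trans (ENNReal.ofReal_le_ofReal h)⟩

theorem measurable_decreasingRearrangement (f : ℝ → ℂ) :
    Measurable (decreasingRearrangement f) :=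
  (decreasingRearrangement_anti f).measurable

theorem le_decreasingRearrangement {f : ℝ → ℂ} {t : ℝ} {s : ℝ≥0∞}
    (h : ENNReal.ofReal t < distributionFun f s) : s ≤ decreasingRearrangement f t := by
  refine le_sInf fun σ hσ => ?_
  by_contra! hlt
  exact absurd (h.trans_le (distributionFun_anti f hlt.le)) (not_lt.2 hσ.2)

/-- A function dominated by a decreasing one has its rearrangement dominated by it as well. -/
theorem decreasingRearrangement_le_of_enorm_le {h : ℝ → ℂ} {g : ℝ → ℝ≥0∞}
    (hg : AntitoneOn g (Ioi 0)) (hh : ∀ y, 0 < y → ‖h y‖ₑ ≤ g y) {y : ℝ} (hy : 0 < y) :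
    decreasingRearrangement h y ≤ g y := by
  refine le_of_forall_gt_imp_ge_of_dense fun s hs => sInf_le ⟨hs.pos, ?_⟩
  have : {x : ℝ | 0 < x ∧ s < ‖h x‖ₑ} ⊆ Ioc 0 y := fun x hx => by
    refine ⟨hx.1, ?_⟩
    by_contra! hlt
    exact absurd (hx.2.trans_le ((hh x hx.1).trans (hg hy hx.1 hlt.le))) (not_lt.2 hs.le)
  refine (measure_mono this).trans ?_
  simp

/-- Both sides are integrals of the measures of superlevel sets; those of `|f|` in `(0, X]` have
measure at most `min X (d_f s)`, and those of `f*` contain `(0, min X (d_f s))`. -/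
theorem lintegral_Ioc_enorm_le {f : ℝ → ℂ}
    (hf : AEStronglyMeasurable f (volume.restrict (Ioi (0 : ℝ)))) (X : ℝ) :
    ∫⁻ t in Ioc 0 X, ‖f t‖ₑ ≤ ∫⁻ t in Ioc 0 X, decreasingRearrangement f t := by
  have hf' : AEStronglyMeasurable f (volume.restrict (Ioc 0 X)) :=
    hf.mono_measure (Measure.restrict_mono Ioc_subset_Ioi_self le_rfl)
  have h1 : ∫⁻ t in Ioc 0 X, ‖f t‖ₑ = ∫⁻ s in Ioi (0 : ℝ),
      (volume.restrict (Ioc 0 X)) {t | s < ‖f t‖} := by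
    rw [← lintegral_eq_lintegral_meas_lt _ (Eventually.of_forall fun _ => norm_nonneg _)
      hf'.norm.aemeasurable]
    simp only [ofReal_norm]
  have h2 := lintegral_mul_eq_lintegral_superlevel (μ := volume.restrict (Ioc 0 X))
    (measurable_decreasingRearrangement f) (u := fun _ => 1) aemeasurable_const
  simp only [mul_one, lintegral_one, Measure.restrict_apply_univ] at h2
  rw [h1, h2]
  refine setLIntegral_mono' measurableSet_Ioi fun s hs => ?_
  have hle : (volume.restrict (Ioc 0 X)) {t | s < ‖f t‖} ≤
      min (ENNReal.ofReal X) (distributionFun f (ENNReal.ofReal s)) := by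
    refine le_min ?_ ?_
    · refine (measure_mono (subset_univ _)).trans ?_
      simp
    · rw [Measure.restrict_apply' measurableSet_Ioc]
      refine measure_mono fun t ht => ⟨ht.2.1, ?_⟩
      rw [← ofReal_norm, ENNReal.ofReal_lt_ofReal_iff_of_nonneg (le_of_lt hs)]
      exact ht.1
  refine hle.trans ?_
  rw [Measure.restrict_apply' measurableSet_Ioc]
  set d := min (ENNReal.ofReal X) (distributionFun f (ENNReal.ofReal s)) with hd
  have hdt : d ≠ ∞ := ne_top_of_le_ne_top ENNReal.ofReal_ne_top (min_le_left _ _)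
  calc d = volume (Ioo 0 d.toReal) := by
        rw [Real.volume_Ioo, sub_zero, ENNReal.ofReal_toReal hdt]
    _ ≤ _ := measure_mono fun t ht => by
        have htd : ENNReal.ofReal t < d := (ENNReal.ofReal_lt_iff_lt_toReal ht.1.le hdt).2 ht.2
        refine ⟨le_decreasingRearrangement (htd.trans_le (min_le_right _ _)), ht.1, ?_⟩
        exact (ENNReal.ofReal_lt_ofReal_iff'.1 (htd.trans_le (min_le_left _ _))).1.le

/-! ### Hardy averages -/

/-- The operator `u ↦ ∫₀^∞ min(1, x/t) u(t) dt = ∫₀ˣ u + x ∫ₓ^∞ u(t) dt / t`, the sum of the two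
Hardy averages of `u` at `x`, up to normalisation. -/
noncomputable def hardySum (u : ℝ → ℝ≥0∞) (x : ℝ) : ℝ≥0∞ :=
  ∫⁻ t in Ioi (0 : ℝ), ENNReal.ofReal (min 1 (x / t)) * u t

theorem hardySum_mono (u : ℝ → ℝ≥0∞) : Monotone (hardySum u) := fun x y h => by
  refine setLIntegral_mono' measurableSet_Ioi fun t ht => ?_
  have : (0 : ℝ) < t := ht
  gcongr

/-- The weight `min(1, x/t)` is a superposition of indicators of intervals `(0, r]`. -/
theorem hardySum_eq {u : ℝ → ℝ≥0∞} (hu : AEMeasurable u (volume.restrict (Ioi (0 : ℝ)))) (x : ℝ) :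
    hardySum u x = ∫⁻ s in Ioc (0 : ℝ) 1, ∫⁻ t in Ioc 0 (x / s), u t := by
  rw [hardySum, lintegral_mul_eq_lintegral_superlevel (by fun_prop) hu,
    ← Ioc_union_Ioi_eq_Ioi zero_le_one, lintegral_union measurableSet_Ioi]
  · have h0 : ∫⁻ s in Ioi (1 : ℝ), ∫⁻ t in {t | ENNReal.ofReal s ≤ ENNReal.ofReal (min 1 (x / t))},
        u t ∂(volume.restrict (Ioi (0 : ℝ))) = 0 := by
      rw [← lintegral_zero (μ := volume.restrict (Ioi (1 : ℝ)))]
      refine setLIntegral_congr_fun measurableSet_Ioi fun s hs => ?_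
      have hs : (1 : ℝ) < s := hs
      have : {t | ENNReal.ofReal s ≤ ENNReal.ofReal (min 1 (x / t))} = ∅ := by
        ext t
        simp only [mem_ofPred_eq, mem_empty_iff_false, iff_false, not_le]
        rw [ENNReal.ofReal_lt_ofReal_iff (by linarith)]
        exact (min_le_left _ _).trans_lt hs
      rw [this, Measure.restrict_empty, lintegral_zero_measure]
    rw [Ioc_union_Ioi_eq_Ioi zero_le_one, h0, add_zero]
    refine setLIntegral_congr_fun measurableSet_Ioc fun s hs => ?_
    have hm : MeasurableSet {t | ENNReal.ofReal s ≤ ENNReal.ofReal (min 1 (x / t))} :=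
      measurableSet_le (by fun_prop) (by fun_prop)
    rw [Measure.restrict_restrict hm]
    congr 2
    ext t
    simp only [mem_inter_iff, mem_ofPred_eq, mem_Ioi, mem_Ioc]
    rw [and_comm]
    refine and_congr_right fun ht => ?_
    rw [ENNReal.ofReal_le_ofReal_iff', le_min_iff, le_div_iff₀ ht, le_div_iff₀ hs.1, mul_comm]
    constructor
    · rintro (h | h)
      · exact h.2
      · exact absurd hs.1 (not_lt.2 h)
    · exact fun h => Or.inl ⟨hs.2, h⟩
  · exact disjoint_left.2 fun s h1 h2 => absurd h1.2 (not_le.2 h2)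

/-- The Hardy–Littlewood inequality for the decreasing weight `min(1, x/t)`. -/
theorem hardySum_enorm_le {f : ℝ → ℂ}
    (hf : AEStronglyMeasurable f (volume.restrict (Ioi (0 : ℝ)))) (x : ℝ) :
    hardySum (fun t => ‖f t‖ₑ) x ≤ hardySum (decreasingRearrangement f) x := by
  rw [hardySum_eq hf.enorm, hardySum_eq (measurable_decreasingRearrangement f).aemeasurable]
  exact lintegral_mono fun s => lintegral_Ioc_enorm_le hf _

theorem lintegral_Ioc_le_hardySum (u : ℝ → ℝ≥0∞) {x : ℝ} :
    ∫⁻ t in Ioc 0 x, u t ≤ hardySum u x := by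
  refine le_trans ?_ (lintegral_mono_set (Ioc_subset_Ioi_self : Ioc 0 x ⊆ Ioi 0))
  refine setLIntegral_mono' measurableSet_Ioc fun t ht => ?_
  rw [min_eq_left ((one_le_div ht.1).2 ht.2), ENNReal.ofReal_one, one_mul]

theorem lintegral_Ioi_div_le_hardySum (u : ℝ → ℝ≥0∞) {x c : ℝ} (hx : 0 < x) (hc : 1 ≤ c) :
    ENNReal.ofReal x * ∫⁻ t in Ioi (x / c), u t / ENNReal.ofReal t ≤
      ENNReal.ofReal c * hardySum u x := by
  have hc0 : 0 < c := by linarith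
  rw [hardySum, ← lintegral_const_mul' _ _ ENNReal.ofReal_ne_top,
    ← lintegral_const_mul' _ _ ENNReal.ofReal_ne_top]
  refine le_trans ?_ (lintegral_mono_set (Ioi_subset_Ioi (by positivity : 0 ≤ x / c)))
  refine setLIntegral_mono' measurableSet_Ioi fun t ht => ?_
  have ht' : x / c < t := ht
  have ht0 : 0 < t := lt_trans (by positivity) ht'
  rw [div_eq_mul_inv, ← ENNReal.ofReal_inv_of_pos ht0, mul_comm (u t), ← mul_assoc, ← mul_assoc,
    ← ENNReal.ofReal_mul hx.le, ← ENNReal.ofReal_mul hc0.le, ← div_eq_mul_inv]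
  gcongr
  rw [div_lt_iff₀ hc0] at ht'
  rcases min_choice 1 (x / t) with h | h <;> rw [h]
  · rw [div_le_iff₀ ht0]; nlinarith
  · exact le_mul_of_one_le_left (by positivity) hc

/-! ### Norms with respect to the dilation invariant measure -/

/-- The `L^q` norm on `(0, ∞)` with respect to the dilation invariant measure `dx / x`. -/
noncomputable def haarLpNorm (q : ℝ≥0∞) (F : ℝ → ℝ≥0∞) : ℝ≥0∞ :=
  if q = ∞ then ⨆ x ∈ Ioi (0 : ℝ), F x
  else (∫⁻ x in Ioi (0 : ℝ), F x ^ q.toReal / ENNReal.ofReal x) ^ (1 / q.toReal)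

theorem lorentzNorm_eq_haarLpNorm (p : ℝ) (q : ℝ≥0∞) (f : ℝ → ℂ) :
    lorentzNorm p q f =
      haarLpNorm q fun x => ENNReal.ofReal (x ^ (1 / p)) * decreasingRearrangement f x := rfl

theorem haarLpNorm_mono {q : ℝ≥0∞} {F G : ℝ → ℝ≥0∞} (h : ∀ x, 0 < x → F x ≤ G x) :
    haarLpNorm q F ≤ haarLpNorm q G := by
  unfold haarLpNorm
  split_ifs
  · exact iSup₂_mono h
  · refine ENNReal.rpow_le_rpow (setLIntegral_mono' measurableSet_Ioi fun x hx => ?_) (by positivity)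
    gcongr
    exact h x hx

theorem haarLpNorm_const_mul {q : ℝ≥0∞} (hq : 1 ≤ q) {c : ℝ≥0∞} (hc : c ≠ ∞) (F : ℝ → ℝ≥0∞) :
    haarLpNorm q (fun x => c * F x) = c * haarLpNorm q F := by
  unfold haarLpNorm
  split_ifs with h
  · simp only [ENNReal.mul_iSup]
  · have hr : 0 < q.toReal := ENNReal.toReal_pos (by positivity) h
    simp only [ENNReal.mul_rpow_of_nonneg _ _ hr.le, mul_div_assoc]
    rw [lintegral_const_mul' _ _ (ENNReal.rpow_ne_top_of_nonneg hr.le hc),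
      ENNReal.mul_rpow_of_nonneg _ _ (by positivity), ← ENNReal.rpow_mul,
      mul_one_div_cancel hr.ne', ENNReal.rpow_one]

theorem image_div_Ioi {s : ℝ} (hs : 0 < s) : (fun y => s / y) '' Ioi 0 = Ioi 0 := by
  ext x
  constructor
  · rintro ⟨y, hy, rfl⟩
    exact div_pos hs hy
  · intro hx
    have hx : 0 < x := hx
    exact ⟨s / x, div_pos hs hx, by field_simp⟩

/-- The measure `dx / x` is invariant under `y ↦ s / y`. -/
theorem lintegral_Ioi_comp_div_div {s : ℝ} (hs : 0 < s) (g : ℝ → ℝ≥0∞) :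
    ∫⁻ y in Ioi (0 : ℝ), g (s / y) / ENNReal.ofReal y =
      ∫⁻ x in Ioi (0 : ℝ), g x / ENNReal.ofReal x := by
  have h := lintegral_image_eq_lintegral_abs_deriv_mul (s := Ioi (0 : ℝ)) (f := fun y => s / y)
    (f' := fun y => s * -(y ^ 2)⁻¹) measurableSet_Ioi
    (fun y hy => by
      simpa only [div_eq_mul_inv] using ((hasDerivAt_inv (ne_of_gt hy)).const_mul s).hasDerivWithinAt)
    (fun x hx y hy hxy => by
      have hx : 0 < x := hx
      have hy : 0 < y := hy
      have hxy : s / x = s / y := hxy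
      rw [div_eq_div_iff hx.ne' hy.ne'] at hxy
      exact (mul_left_cancel₀ hs.ne' hxy).symm)
    (fun x => g x / ENNReal.ofReal x)
  rw [image_div_Ioi hs] at h
  rw [h]
  refine setLIntegral_congr_fun measurableSet_Ioi fun y hy => ?_
  have hy : 0 < y := hy
  rw [div_eq_mul_inv _ (ENNReal.ofReal y), div_eq_mul_inv _ (ENNReal.ofReal (s / y)),
    ← ENNReal.ofReal_inv_of_pos hy,
    ← ENNReal.ofReal_inv_of_pos (div_pos hs hy), mul_left_comm, ← ENNReal.ofReal_mul (abs_nonneg _)]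
  congr 2
  rw [mul_neg, abs_neg, abs_of_pos (by positivity)]
  field_simp

theorem lintegral_Ioi_eq_comp_div {y : ℝ} (hy : 0 < y) (g : ℝ → ℝ≥0∞) :
    ∫⁻ t in Ioi (0 : ℝ), g t = ∫⁻ s in Ioi (0 : ℝ), ENNReal.ofReal (1 / y) * g (s / y) := by
  have himg : (fun s => s / y) '' Ioi 0 = Ioi 0 := by
    ext x
    constructor
    · rintro ⟨s, hs, rfl⟩
      exact div_pos hs hy
    · intro hx
      exact ⟨x * y, mul_pos hx hy, by field_simp⟩
  have h := lintegral_image_eq_lintegral_abs_deriv_mul (s := Ioi (0 : ℝ)) (f := fun s => s / y)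
    (f' := fun _ => 1 / y) measurableSet_Ioi
    (fun s _ => ((hasDerivAt_id s).div_const y).hasDerivWithinAt)
    (fun a _ b _ hab => by
      have hab : a / y = b / y := hab
      field_simp at hab
      exact hab) g
  rw [himg] at h
  rw [h, abs_of_pos (by positivity)]

/-- Jensen's inequality for an unnormalised weight. -/
theorem lintegral_mul_rpow_le {μ : Measure ℝ} {k F : ℝ → ℝ≥0∞} (hk : Measurable k)
    (hF : Measurable F) {r : ℝ} (hr : 1 ≤ r) :
    (∫⁻ s, k s * F s ∂μ) ^ r ≤ (∫⁻ s, k s ∂μ) ^ (r - 1) * ∫⁻ s, k s * F s ^ r ∂μ := by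
  have hr0 : 0 < r := by linarith
  have h1 : 0 ≤ 1 - 1 / r := by
    rw [sub_nonneg, div_le_one hr0]; exact hr
  have h := ENNReal.lintegral_mul_norm_pow_le (μ := μ) (f := k) (g := fun s => k s * F s ^ r)
    hk.aemeasurable (by fun_prop) h1 (by positivity : 0 ≤ 1 / r) (by ring)
  have e : ∀ s, k s ^ (1 - 1 / r) * (k s * F s ^ r) ^ (1 / r) = k s * F s := fun s => by
    rw [ENNReal.mul_rpow_of_nonneg _ _ (by positivity), ← ENNReal.rpow_mul,
      mul_one_div_cancel hr0.ne', ENNReal.rpow_one, ← mul_assoc,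
      ← ENNReal.rpow_add_of_nonneg _ _ h1 (by positivity)]
    simp
  simp only [e] at h
  refine (ENNReal.rpow_le_rpow h hr0.le).trans (le_of_eq ?_)
  rw [ENNReal.mul_rpow_of_nonneg _ _ hr0.le, ← ENNReal.rpow_mul, ← ENNReal.rpow_mul,
    one_div_mul_cancel hr0.ne', ENNReal.rpow_one]
  congr 2
  field_simp

/-- Minkowski's inequality for a superposition of dilations, which are isometries
for `dx / x`. -/
theorem haarLpNorm_lintegral_comp_div_le {q : ℝ≥0∞} (hq : 1 ≤ q) {k F : ℝ → ℝ≥0∞}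
    (hk : Measurable k) (hF : Measurable F) :
    haarLpNorm q (fun y => ∫⁻ s in Ioi (0 : ℝ), k s * F (s / y)) ≤
      (∫⁻ s in Ioi (0 : ℝ), k s) * haarLpNorm q F := by
  unfold haarLpNorm
  split_ifs with h
  · refine iSup₂_le fun y hy => ?_
    rw [← lintegral_mul_const _ hk]
    refine setLIntegral_mono' measurableSet_Ioi fun s hs => ?_
    gcongr
    exact le_iSup₂ (f := fun (x : ℝ) (_ : x ∈ Ioi (0 : ℝ)) => F x) (s / y)
      (mem_Ioi.2 (div_pos (mem_Ioi.1 hs) (mem_Ioi.1 hy)))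
  · set r := q.toReal
    have hr : 1 ≤ r := by
      simpa using ENNReal.toReal_mono h hq
    have hr0 : 0 < r := by linarith
    set κ := ∫⁻ s in Ioi (0 : ℝ), k s
    have hmeas : Measurable (Function.uncurry fun y s : ℝ =>
        k s * F (s / y) ^ r / ENNReal.ofReal y) := by
      unfold Function.uncurry
      fun_prop
    have h1 : ∫⁻ y in Ioi (0 : ℝ), (∫⁻ s in Ioi (0 : ℝ), k s * F (s / y)) ^ r / ENNReal.ofReal y ≤
        κ ^ r * ∫⁻ x in Ioi (0 : ℝ), F x ^ r / ENNReal.ofReal x := by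
      calc _ ≤ ∫⁻ y in Ioi (0 : ℝ), κ ^ (r - 1) *
            ∫⁻ s in Ioi (0 : ℝ), k s * F (s / y) ^ r / ENNReal.ofReal y := by
            refine lintegral_mono fun y => ?_
            simp only [div_eq_mul_inv _ (ENNReal.ofReal y)]
            rw [lintegral_mul_const _ (by fun_prop), ← mul_assoc]
            gcongr
            exact lintegral_mul_rpow_le hk (by fun_prop) hr
        _ = κ ^ (r - 1) * ∫⁻ s in Ioi (0 : ℝ), ∫⁻ y in Ioi (0 : ℝ),
            k s * F (s / y) ^ r / ENNReal.ofReal y := by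
            rw [lintegral_const_mul _ (Measurable.lintegral_prod_right hmeas),
              lintegral_lintegral_swap hmeas.aemeasurable]
        _ = κ ^ (r - 1) * ∫⁻ s in Ioi (0 : ℝ),
            k s * ∫⁻ x in Ioi (0 : ℝ), F x ^ r / ENNReal.ofReal x := by
            congr 1
            refine setLIntegral_congr_fun measurableSet_Ioi fun s hs => ?_
            simp only [mul_div_assoc]
            rw [lintegral_const_mul _ (by fun_prop),
              lintegral_Ioi_comp_div_div hs fun x => F x ^ r]
        _ = _ := by
            rw [lintegral_mul_const _ hk, ← mul_assoc]
            congr 1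
            conv_lhs => rw [← ENNReal.rpow_one (∫⁻ s in Ioi (0 : ℝ), k s)]
            rw [← ENNReal.rpow_add_of_nonneg _ _ (by linarith) zero_le_one, sub_add_cancel]
    refine (ENNReal.rpow_le_rpow h1 (by positivity)).trans (le_of_eq ?_)
    rw [ENNReal.mul_rpow_of_nonneg _ _ (by positivity), ← ENNReal.rpow_mul,
      mul_one_div_cancel hr0.ne', ENNReal.rpow_one]

theorem ae_ne_top_of_haarLpNorm_ne_top {q : ℝ≥0∞} (hq : 1 ≤ q) {F : ℝ → ℝ≥0∞} (hF : Measurable F)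
    (h : haarLpNorm q F ≠ ∞) : ∀ᵐ x ∂volume.restrict (Ioi (0 : ℝ)), F x ≠ ∞ := by
  unfold haarLpNorm at h
  rw [ae_restrict_iff' measurableSet_Ioi]
  split_ifs at h with hq'
  · refine Eventually.of_forall fun x hx => ne_top_of_le_ne_top h ?_
    exact le_iSup₂ (f := fun (x : ℝ) (_ : x ∈ Ioi (0 : ℝ)) => F x) x hx
  · have hr : 0 < q.toReal := ENNReal.toReal_pos (by positivity) hq'
    have h2 : ∫⁻ x in Ioi (0 : ℝ), F x ^ q.toReal / ENNReal.ofReal x ≠ ∞ := fun h2 => by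
      rw [h2, ENNReal.top_rpow_of_pos (by positivity)] at h
      exact h rfl
    have h3 := ae_lt_top (by fun_prop) h2
    rw [ae_restrict_iff' measurableSet_Ioi] at h3
    filter_upwards [h3] with x hx hx0 hF
    have := hx hx0
    rw [hF, ENNReal.top_rpow_of_pos hr, ENNReal.top_div_of_ne_top ENNReal.ofReal_ne_top] at this
    exact lt_irrefl _ this

/-! ### Hardy averages in Lorentz spaces -/

/-- The kernel by which `y ↦ y^{1-θ} hardySum u (1/y)` is a superposition of dilations of the
reflection of `x ↦ x^θ u(x)`. -/
noncomputable def hardyWeight (θ s : ℝ) : ℝ≥0∞ := ENNReal.ofReal (min 1 (1 / s) * s ^ (-θ))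

theorem measurable_hardyWeight (θ : ℝ) : Measurable (hardyWeight θ) := by
  unfold hardyWeight
  fun_prop

theorem lintegral_hardyWeight_lt_top {θ : ℝ} (h0 : 0 < θ) (h1 : θ < 1) :
    ∫⁻ s in Ioi (0 : ℝ), hardyWeight θ s < ∞ := by
  rw [← Ioc_union_Ioi_eq_Ioi zero_le_one]
  refine (lintegral_union_le _ _ _).trans_lt (ENNReal.add_lt_top.2 ⟨?_, ?_⟩)
  · have hi : IntegrableOn (fun s : ℝ => s ^ (-θ)) (Ioc 0 1) :=
      (intervalIntegrable_iff_integrableOn_Ioc_of_le zero_le_one).1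
        (intervalIntegral.intervalIntegrable_rpow' (by linarith))
    refine lt_of_le_of_lt (setLIntegral_mono' measurableSet_Ioc fun s hs => ?_) hi.2
    have hs0 : 0 < s := hs.1
    rw [Real.enorm_eq_ofReal (by positivity)]
    exact ENNReal.ofReal_le_ofReal (mul_le_of_le_one_left (by positivity) (min_le_left _ _))
  · have hi : IntegrableOn (fun s : ℝ => s ^ (-1 - θ)) (Ioi 1) :=
      integrableOn_Ioi_rpow_of_lt (by linarith) one_pos
    refine lt_of_le_of_lt (setLIntegral_mono' measurableSet_Ioi fun s hs => ?_) hi.2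
    have hs0 : 0 < s := one_pos.trans hs
    rw [Real.enorm_eq_ofReal (by positivity)]
    refine ENNReal.ofReal_le_ofReal ?_
    change min 1 (1 / s) * s ^ (-θ) ≤ s ^ (-1 - θ)
    rw [show -1 - θ = -1 + -θ by ring, Real.rpow_add hs0, Real.rpow_neg_one]
    gcongr
    exact (min_le_right _ _).trans (one_div s).le

theorem rpow_mul_hardySum_one_div (u : ℝ → ℝ≥0∞) (θ : ℝ) {y : ℝ} (hy : 0 < y) :
    ENNReal.ofReal (y ^ (1 - θ)) * hardySum u (1 / y) =
      ∫⁻ s in Ioi (0 : ℝ), hardyWeight θ s * (ENNReal.ofReal ((s / y) ^ θ) * u (s / y)) := by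
  rw [hardySum, lintegral_Ioi_eq_comp_div hy, ← lintegral_const_mul' _ _ ENNReal.ofReal_ne_top]
  refine setLIntegral_congr_fun measurableSet_Ioi fun s hs => ?_
  have hs : 0 < s := hs
  simp only [hardyWeight, ← mul_assoc]
  rw [← ENNReal.ofReal_mul (by positivity), ← ENNReal.ofReal_mul (by positivity),
    ← ENNReal.ofReal_mul (by positivity)]
  congr 2
  rw [div_div_div_cancel_right₀ hy.ne', Real.rpow_sub hy, Real.rpow_one, Real.rpow_neg hs.le,
    Real.div_rpow hs.le hy.le]
  have h1 : s ^ θ ≠ 0 := by positivity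
  have h2 : y ^ θ ≠ 0 := by positivity
  field_simp

/-- The weighted norm of the sum of Hardy averages of `f*` is controlled by the Lorentz norm
of `f`. -/
theorem haarLpNorm_hardySum_le {p : ℝ} {q : ℝ≥0∞} (hq : 1 ≤ q) (f : ℝ → ℂ) :
    haarLpNorm q (fun y => ENNReal.ofReal (y ^ (1 - 1 / p)) *
      hardySum (decreasingRearrangement f) (1 / y)) ≤
      (∫⁻ s in Ioi (0 : ℝ), hardyWeight (1 / p) s) * lorentzNorm p q f := by
  have hm := measurable_decreasingRearrangement f
  refine le_trans (haarLpNorm_mono fun y hy => (rpow_mul_hardySum_one_div _ _ hy).le) ?_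
  exact haarLpNorm_lintegral_comp_div_le (F := fun x => ENNReal.ofReal (x ^ (1 / p)) *
    decreasingRearrangement f x) hq (measurable_hardyWeight _) (by fun_prop)

/-- The Hardy sum is finite almost everywhere by the norm estimate, and it is monotone, so it is
finite everywhere; no embedding between Lorentz spaces is needed. -/
theorem hardySum_decreasingRearrangement_ne_top {p : ℝ} (hp : 1 < p) {q : ℝ≥0∞} (hq : 1 ≤ q)
    {f : ℝ → ℂ} (hf : lorentzNorm p q f < ∞) (x : ℝ) :
    hardySum (decreasingRearrangement f) x ≠ ∞ := by
  have hθ0 : 0 < 1 / p := by positivity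
  have hθ1 : 1 / p < 1 := (div_lt_one (by linarith)).2 hp
  have hfin := ne_top_of_le_ne_top
    (ENNReal.mul_ne_top (lintegral_hardyWeight_lt_top hθ0 hθ1).ne hf.ne)
    (haarLpNorm_hardySum_le hq f)
  have hm : Measurable (hardySum (decreasingRearrangement f)) := (hardySum_mono _).measurable
  have hae := ae_ne_top_of_haarLpNorm_ne_top hq (by fun_prop) hfin
  -- Finiteness at a single `y ≤ 1 / x` suffices, as the Hardy sum is monotone.
  set b : ℝ := 1 / max x 1
  have hb : 0 < b := by positivity
  have hae' : ∀ᵐ y ∂volume.restrict (Ioc 0 b), ENNReal.ofReal (y ^ (1 - 1 / p)) *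
      hardySum (decreasingRearrangement f) (1 / y) ≠ ∞ :=
    ae_restrict_of_ae_restrict_of_subset Ioc_subset_Ioi_self hae
  have : (ae (volume.restrict (Ioc 0 b))).NeBot := ae_restrict_neBot.2 (by simpa using hb)
  obtain ⟨y, hy, hyfin⟩ := ((ae_restrict_mem measurableSet_Ioc).and hae').exists
  have hy0 : 0 < y := hy.1
  have hxy : x ≤ 1 / y := by
    have : max x 1 ≤ 1 / y := by
      rw [le_one_div (by positivity) hy0]; exact hy.2
    exact (le_max_left _ _).trans this
  refine ne_top_of_le_ne_top (fun htop => hyfin ?_) (hardySum_mono _ hxy)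
  rw [htop, ENNReal.mul_top]
  simpa using Real.rpow_pos_of_pos hy0 _

/-- A function dominated at `y` by the Hardy sum of `f*` at `1/y` lies in the conjugate
Lorentz space. -/
theorem lorentzNorm_conjExponent_le {p : ℝ} (hp : 1 < p) {q : ℝ≥0∞} (hq : 1 ≤ q) {f h : ℝ → ℂ}
    {c : ℝ≥0∞} (hc : c ≠ ∞)
    (hh : ∀ y, 0 < y → ‖h y‖ₑ ≤ c * hardySum (decreasingRearrangement f) (1 / y)) :
    lorentzNorm (Real.conjExponent p) q h ≤
      c * (∫⁻ s in Ioi (0 : ℝ), hardyWeight (1 / p) s) * lorentzNorm p q f := by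
  have he : 1 / Real.conjExponent p = 1 - 1 / p := by
    have : p - 1 ≠ 0 := by linarith
    rw [Real.conjExponent]
    field_simp
  have hanti : AntitoneOn (fun y => c * hardySum (decreasingRearrangement f) (1 / y)) (Ioi 0) :=
    fun a ha b _ hab => by
      simp only
      gcongr
      exact hardySum_mono _ (one_div_le_one_div_of_le ha hab)
  rw [lorentzNorm_eq_haarLpNorm, he, mul_assoc]
  refine le_trans (haarLpNorm_mono (G := fun y => c * (ENNReal.ofReal (y ^ (1 - 1 / p)) *
    hardySum (decreasingRearrangement f) (1 / y))) fun y hy => ?_) ?_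
  · rw [mul_left_comm]
    gcongr
    exact decreasingRearrangement_le_of_enorm_le hanti hh hy
  · rw [haarLpNorm_const_mul hq hc]
    gcongr
    exact haarLpNorm_hardySum_le hq f

/-! ### Improper integrals against oscillating kernels -/

/-- Over `[a, b]` with `y a ≥ 1`, the oscillation of the kernel `φ(x y)` bounds the integral of
`f` against it by the variation of `f`. -/
theorem norm_integral_mul_comp_mul_le {f : ℝ → ℂ} {φ : ℝ → ℝ} {B : ℝ} (hB0 : 0 ≤ B)
    (hφc : ContinuousOn φ (Ioi 0))
    (hB : ∀ a b, 1 ≤ a → a ≤ b → |∫ t in a..b, φ t| ≤ B) {y a b : ℝ} (hy : 0 < y)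
    (ha : 1 / y ≤ a) (hab : a ≤ b) (hV : eVariationOn f (Ici a) ≠ ∞)
    (hf : IntervalIntegrable f volume a b)
    (hf0 : ∫⁻ t in Ioi b, ‖f t‖ₑ / ENNReal.ofReal t ≠ ∞) :
    ‖∫ x in a..b, f x * (φ (x * y) : ℂ)‖ ≤ 2 * B / y * (eVariationOn f (Ici a)).toReal := by
  have ha0 : 0 < a := lt_of_lt_of_le (by positivity) ha
  have hVab : eVariationOn f (Icc a b) ≤ eVariationOn f (Ici a) :=
    eVariationOn.mono f Icc_subset_Ici_self
  have hVb : eVariationOn f (Ici b) ≤ eVariationOn f (Ici a) :=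
    eVariationOn.mono f (Ici_subset_Ici.2 hab)
  have h := norm_integral_mul_le_of_eVariationOn (f := f) (ψ := fun x => φ (x * y)) (B := B / y)
    hab (ne_top_of_le_ne_top hV hVab) hf
    (hφc.comp (by fun_prop) fun x hx => mul_pos (ha0.trans_le hx.1) hy) (fun c hc => by
      rw [intervalIntegral.integral_comp_mul_right _ hy.ne', smul_eq_mul, abs_mul,
        abs_of_pos (by positivity), inv_mul_eq_div]
      gcongr
      refine hB _ _ ?_ (by gcongr; exact hc.1)
      rwa [div_le_iff₀ hy] at ha)
  have h1 : ‖f b‖ ≤ (eVariationOn f (Ici a)).toReal := by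
    rw [← toReal_enorm]
    exact ENNReal.toReal_mono hV ((enorm_le_eVariationOn_Ici hf0).trans hVb)
  have h2 := ENNReal.toReal_mono hV hVab
  calc _ ≤ _ := h
    _ ≤ B / y * ((eVariationOn f (Ici a)).toReal + (eVariationOn f (Ici a)).toReal) := by gcongr
    _ = _ := by ring

/-- Existence of, and a bound for, the improper integral of `f` against an oscillating
bounded kernel: the part over `(0, 1/y]` converges absolutely, the part over `[1/y, ∞)` by
bounded variation. -/
theorem exists_tendsto_integral_mul_comp_mul {f : ℝ → ℂ} {φ : ℝ → ℝ} {A B : ℝ} (hB0 : 0 ≤ B)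
    (hφc : ContinuousOn φ (Ioi 0)) (hA : ∀ t, 0 < t → |φ t| ≤ A)
    (hB : ∀ a b, 1 ≤ a → a ≤ b → |∫ t in a..b, φ t| ≤ B)
    (hf : AEStronglyMeasurable f (volume.restrict (Ioi (0 : ℝ))))
    (hf1 : ∀ b, ∫⁻ t in Ioc 0 b, ‖f t‖ₑ ≠ ∞)
    (hf2 : ∀ b, 0 < b → ∫⁻ t in Ioi b, ‖f t‖ₑ / ENNReal.ofReal t ≠ ∞)
    {y : ℝ} (hy : 0 < y) (hV : eVariationOn f (Ici (1 / y)) ≠ ∞) :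
    ∃ l : ℂ, Tendsto (fun MN : ℝ × ℝ => ∫ x in MN.1..MN.2, f x * (φ (x * y) : ℂ))
        (𝓝[>] (0 : ℝ) ×ˢ atTop) (𝓝 l) ∧
      ‖l‖ₑ ≤ ENNReal.ofReal A * (∫⁻ t in Ioc 0 (1 / y), ‖f t‖ₑ) +
        ENNReal.ofReal (2 * B / y) * eVariationOn f (Ici (1 / y)) := by
  set a : ℝ := 1 / y with ha
  have ha0 : 0 < a := by positivity
  set h : ℝ → ℂ := fun x => f x * (φ (x * y) : ℂ) with hh
  have hfi : ∀ b, IntegrableOn f (Ioc 0 b) := fun b =>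
    ⟨hf.mono_measure (Measure.restrict_mono Ioc_subset_Ioi_self le_rfl),
      lt_top_iff_ne_top.2 (hf1 b)⟩
  have hφy : ContinuousOn (fun x => (φ (x * y) : ℂ)) (Ioi 0) :=
    Complex.continuous_ofReal.comp_continuousOn
      (hφc.comp (by fun_prop) fun x hx => mul_pos hx hy)
  have hi : ∀ b, IntegrableOn h (Ioc 0 b) := fun b => by
    refine (hfi b).mul_bdd (c := A) ?_ ?_
    · exact (hφy.mono Ioc_subset_Ioi_self).aestronglyMeasurable measurableSet_Ioc
    · refine (ae_restrict_mem measurableSet_Ioc).mono fun x hx => ?_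
      rw [Complex.norm_real]
      exact hA _ (mul_pos hx.1 hy)
  have hii : ∀ {u : ℝ → ℂ} (_ : ∀ b, IntegrableOn u (Ioc 0 b)) {c d : ℝ}, 0 ≤ c → 0 ≤ d →
      IntervalIntegrable u volume c d := fun {u} hu {c d} hc hd => by
    rw [intervalIntegrable_iff]
    exact (hu (max c d)).mono_set (Ioc_subset_Ioc_left (le_min hc hd))
  have hsmall : Tendsto (fun M => ∫ x in M..a, h x) (𝓝[>] 0) (𝓝 (∫ x in 0..a, h x)) := by
    have hc := intervalIntegral.continuousOn_primitive_interval_left (f := h) (a := 0) (b := a)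
      (μ := volume) (by rw [uIcc_of_le ha0.le, integrableOn_Icc_iff_integrableOn_Ioc]; exact hi a)
    rw [uIcc_of_le ha0.le] at hc
    have := (hc 0 (left_mem_Icc.2 ha0.le)).mono_left
      (nhdsWithin_mono 0 (Ioc_subset_Icc_self (a := 0) (b := a)))
    rwa [nhdsWithin_Ioc_eq_nhdsGT ha0] at this
  have htail : ∀ c d, a ≤ c → c ≤ d →
      ‖∫ x in c..d, h x‖ ≤ 2 * B / y * (eVariationOn f (Ici c)).toReal := fun c d hc hcd =>
    norm_integral_mul_comp_mul_le hB0 hφc hB hy hc hcd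
      (ne_top_of_le_ne_top hV (eVariationOn.mono f (Ici_subset_Ici.2 hc)))
      (hii hfi (ha0.le.trans hc) (ha0.le.trans (hc.trans hcd)))
      (hf2 d (ha0.trans_le (hc.trans hcd)))
  have hV0 : Tendsto (fun c => (eVariationOn f (Ici (max a c))).toReal) atTop (𝓝 0) := by
    have hbv : BoundedVariationOn f (Ici a) := hV
    have h1 := hbv.tendsto_eVariationOn_Ici_zero
    rw [inf_eq_right.2 (le_principal_iff.2 (Ici_mem_atTop a))] at h1
    simp only [Ici_inter_Ici] at h1
    simpa [Function.comp_def] using (ENNReal.tendsto_toReal ENNReal.zero_ne_top).comp h1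
  have hcauchy : CauchySeq fun N => ∫ x in a..max a N, h x := by
    have hord : ∀ N n m : ℝ, N ≤ n → n ≤ m →
        dist (∫ x in a..max a n, h x) (∫ x in a..max a m, h x) ≤
          2 * B / y * (eVariationOn f (Ici (max a N))).toReal := fun N n m hn hm => by
      have hnm : max a n ≤ max a m := max_le_max_left a hm
      have h0n : 0 ≤ max a n := ha0.le.trans (le_max_left _ _)
      rw [dist_comm, dist_eq_norm, ← intervalIntegral.integral_add_adjacent_intervals
        (hii hi ha0.le h0n) (hii hi h0n (h0n.trans hnm)), add_sub_cancel_left]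
      refine (htail _ _ (le_max_left _ _) hnm).trans ?_
      refine mul_le_mul_of_nonneg_left (ENNReal.toReal_mono ?_ (eVariationOn.mono f ?_))
        (by positivity)
      · exact ne_top_of_le_ne_top hV (eVariationOn.mono f (Ici_subset_Ici.2 (le_max_left _ _)))
      · exact Ici_subset_Ici.2 (max_le_max_left a hn)
    refine cauchySeq_of_le_tendsto_0 (fun N => 2 * B / y * (eVariationOn f (Ici (max a N))).toReal)
      (fun n m N hn hm => ?_) (by simpa using hV0.const_mul (2 * B / y))
    rcases le_total n m with hnm | hnm
    · exact hord N n m hn hnm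
    · rw [dist_comm]
      exact hord N m n hm hnm
  obtain ⟨l, hl⟩ := cauchySeq_tendsto_of_complete hcauchy
  refine ⟨(∫ x in 0..a, h x) + l, ?_, ?_⟩
  · refine ((hsmall.comp tendsto_fst).add (hl.comp tendsto_snd)).congr' ?_
    filter_upwards [prod_mem_prod self_mem_nhdsWithin (Ici_mem_atTop a)] with MN hMN
    have hM : 0 < MN.1 := hMN.1
    have hN : a ≤ MN.2 := hMN.2
    simp only [Function.comp, max_eq_right hN]
    exact intervalIntegral.integral_add_adjacent_intervals (hii hi hM.le ha0.le)
      (hii hi ha0.le (ha0.le.trans hN))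
  · refine (enorm_add_le _ _).trans (add_le_add ?_ ?_)
    · rw [intervalIntegral.integral_of_le ha0.le, ← lintegral_const_mul' _ _ ENNReal.ofReal_ne_top]
      refine (enorm_integral_le_lintegral_enorm _).trans
        (setLIntegral_mono' measurableSet_Ioc fun x hx => ?_)
      rw [hh, enorm_mul, mul_comm]
      gcongr
      rw [← ofReal_norm, Complex.norm_real]
      exact ENNReal.ofReal_le_ofReal (hA _ (mul_pos hx.1 hy))
    · have hle : ‖l‖ ≤ 2 * B / y * (eVariationOn f (Ici a)).toReal :=
        le_of_tendsto' hl.norm fun N => htail a _ le_rfl (le_max_left _ _)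
      rw [← ofReal_norm, ← ENNReal.ofReal_toReal hV, ← ENNReal.ofReal_mul (by positivity)]
      exact ENNReal.ofReal_le_ofReal hle

theorem aestronglyMeasurable_integral_mul_comp_mul {f : ℝ → ℂ} {φ : ℝ → ℝ}
    (hφc : ContinuousOn φ (Ioi 0))
    (hf : AEStronglyMeasurable f (volume.restrict (Ioi (0 : ℝ)))) {M N : ℝ} (hM : 0 ≤ M)
    (hMN : M ≤ N) :
    AEStronglyMeasurable (fun y => ∫ x in M..N, f x * (φ (x * y) : ℂ))
      (volume.restrict (Ioi (0 : ℝ))) := by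
  have hφm : Measurable ((Ioi (0 : ℝ)).indicator φ) := by
    rw [← piecewise_eq_indicator]
    exact hφc.measurable_piecewise continuousOn_const measurableSet_Ioi
  have hmeas : StronglyMeasurable fun y => ∫ x in Ioc M N,
      hf.mk f x * (((Ioi (0 : ℝ)).indicator φ (x * y) : ℝ) : ℂ) := by
    refine StronglyMeasurable.integral_prod_right (f := fun y x =>
      hf.mk f x * (((Ioi (0 : ℝ)).indicator φ (x * y) : ℝ) : ℂ)) ?_
    have h1 := hf.stronglyMeasurable_mk.measurable
    refine Measurable.stronglyMeasurable ?_
    unfold Function.uncurry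
    exact (h1.comp measurable_snd).mul
      (Complex.measurable_ofReal.comp (hφm.comp (measurable_snd.mul measurable_fst)))
  refine hmeas.aestronglyMeasurable.congr ?_
  filter_upwards [ae_restrict_mem measurableSet_Ioi] with y hy
  rw [intervalIntegral.integral_of_le hMN]
  have hsub : Ioc M N ⊆ Ioi 0 := fun x hx => hM.trans_lt hx.1
  refine integral_congr_ae ?_
  filter_upwards [ae_restrict_of_ae_restrict_of_subset hsub hf.ae_eq_mk,
    ae_restrict_mem measurableSet_Ioc] with x hx hxm
  rw [hx, indicator_of_mem (mem_Ioi.2 (mul_pos (hsub hxm) hy))]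

/-! ### The Hankel transform -/

theorem continuousOn_sqrt_mul_besselJ {α : ℝ} (hα : -1 < α) :
    ContinuousOn (fun t => Real.sqrt t * besselJ α t) (Ioi 0) :=
  ((continuousOn_besselKernel hα).const_mul ((1 / 2) ^ α)).congr fun _ ht => sqrt_mul_besselJ ht

theorem exists_abs_sqrt_mul_besselJ_le {α : ℝ} (hα : -1 / 2 ≤ α) :
    ∃ A, 0 ≤ A ∧ ∀ t, 0 < t → |Real.sqrt t * besselJ α t| ≤ A := by
  obtain ⟨A, hA0, hA⟩ := exists_abs_besselKernel_le hα
  refine ⟨(1 / 2) ^ α * A, by positivity, fun t ht => ?_⟩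
  rw [sqrt_mul_besselJ ht, abs_mul, abs_of_pos (by positivity)]
  gcongr
  exact hA t ht

theorem exists_abs_integral_sqrt_mul_besselJ_le {α : ℝ} (hα : -1 / 2 ≤ α) :
    ∃ B, 0 ≤ B ∧ ∀ a b, 1 ≤ a → a ≤ b → |∫ t in a..b, Real.sqrt t * besselJ α t| ≤ B := by
  obtain ⟨B, hB0, hB⟩ := exists_abs_integral_besselKernel_le hα
  refine ⟨(1 / 2) ^ α * B, by positivity, fun a b ha hab => ?_⟩
  have h : ∫ t in a..b, Real.sqrt t * besselJ α t =
      ∫ t in a..b, (1 / 2) ^ α * besselKernel α t :=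
    intervalIntegral.integral_congr fun t ht => by
      rw [uIcc_of_le hab] at ht
      exact sqrt_mul_besselJ (by linarith [ht.1])
  rw [h, intervalIntegral.integral_const_mul, abs_mul, abs_of_pos (by positivity)]
  gcongr
  exact hB a b ha hab

/-- The pointwise bound: on general monotone functions the Hankel transform exists and is
dominated, at `y`, by the Hardy averages of `|f|` at `1/y`. -/
theorem exists_hasHankelTransform_le {α : ℝ} (hα : -1 / 2 ≤ α) (C : ℝ) {lam : ℝ}
    (hlam : 1 < lam) :
    ∃ c : ℝ≥0, ∀ f : ℝ → ℂ, IsGeneralMonotone C lam f →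
      AEStronglyMeasurable f (volume.restrict (Ioi (0 : ℝ))) →
      (∀ x, hardySum (fun t => ‖f t‖ₑ) x ≠ ∞) → ∀ y, 0 < y →
      ∃ l, HasHankelTransform α f y l ∧ ‖l‖ₑ ≤ c * hardySum (fun t => ‖f t‖ₑ) (1 / y) := by
  obtain ⟨A, hA0, hA⟩ := exists_abs_sqrt_mul_besselJ_le hα
  obtain ⟨B, hB0, hB⟩ := exists_abs_integral_sqrt_mul_besselJ_le hα
  obtain ⟨m, hm⟩ := pow_unbounded_of_one_lt lam (one_lt_two (α := ℝ))
  refine ⟨Real.toNNReal A + Real.toNNReal (2 * B) * (Real.toNNReal C * ((2 * m : ℕ) *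
    Real.toNNReal (2 ^ m))), fun f hf hfm hfin y hy => ?_⟩
  set u : ℝ → ℝ≥0∞ := fun t => ‖f t‖ₑ
  have h2m : (1 : ℝ) ≤ 2 ^ m := one_le_pow₀ one_le_two
  have hf1 : ∀ b, ∫⁻ t in Ioc 0 b, ‖f t‖ₑ ≠ ∞ := fun b =>
    ne_top_of_le_ne_top (hfin b) (lintegral_Ioc_le_hardySum u)
  have hf2 : ∀ b, 0 < b → ∫⁻ t in Ioi b, ‖f t‖ₑ / ENNReal.ofReal t ≠ ∞ := fun b hb htop => by
    have h := lintegral_Ioi_div_le_hardySum u hb le_rfl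
    rw [div_one, htop, ENNReal.mul_top (by simpa using hb), ENNReal.ofReal_one, one_mul] at h
    exact hfin b (top_le_iff.1 h)
  have hVle := hf.eVariationOn_Ici_le hlam hm.le (one_div_pos.2 hy)
  have hV : eVariationOn f (Ici (1 / y)) ≠ ∞ := by
    refine ne_top_of_le_ne_top (ENNReal.mul_ne_top ENNReal.ofReal_ne_top
      (ENNReal.mul_ne_top (ENNReal.natCast_ne_top _) (hf2 _ ?_))) hVle
    positivity
  obtain ⟨l, hl, hle⟩ := exists_tendsto_integral_mul_comp_mul hB0
    (continuousOn_sqrt_mul_besselJ (by linarith : -1 < α)) hA hB hfm hf1 hf2 hy hV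
  refine ⟨l, hl, hle.trans ?_⟩
  have h1 := lintegral_Ioc_le_hardySum u (x := 1 / y)
  have h2 : ENNReal.ofReal (2 * B / y) * eVariationOn f (Ici (1 / y)) ≤
      ENNReal.ofReal (2 * B) * (ENNReal.ofReal C * ((2 * m : ℕ) *
        (ENNReal.ofReal (2 ^ m) * hardySum u (1 / y)))) := by
    calc _ ≤ ENNReal.ofReal (2 * B / y) * (ENNReal.ofReal C * ((2 * m : ℕ) *
          ∫⁻ t in Ioi (1 / y / 2 ^ m), ‖f t‖ₑ / ENNReal.ofReal t)) := by gcongr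
      _ = ENNReal.ofReal (2 * B) * (ENNReal.ofReal C * ((2 * m : ℕ) *
          (ENNReal.ofReal (1 / y) *
            ∫⁻ t in Ioi (1 / y / 2 ^ m), ‖f t‖ₑ / ENNReal.ofReal t))) := by
          rw [div_eq_mul_one_div (2 * B), ENNReal.ofReal_mul (by positivity)]
          ring
      _ ≤ _ := mul_le_mul' le_rfl (mul_le_mul' le_rfl (mul_le_mul' le_rfl
          (lintegral_Ioi_div_le_hardySum u (one_div_pos.2 hy) h2m)))
  calc _ ≤ ENNReal.ofReal A * hardySum u (1 / y) + ENNReal.ofReal (2 * B) * (ENNReal.ofReal C *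
        ((2 * m : ℕ) * (ENNReal.ofReal (2 ^ m) * hardySum u (1 / y)))) := by
        gcongr
    _ = _ := by
        simp only [ENNReal.ofReal, ENNReal.coe_add, ENNReal.coe_mul, ENNReal.coe_natCast]
        ring

theorem aestronglyMeasurable_hankelTransform {α : ℝ} (hα : -1 < α) {f : ℝ → ℂ}
    (hf : AEStronglyMeasurable f (volume.restrict (Ioi (0 : ℝ))))
    (hlim : ∀ y, 0 < y → HasHankelTransform α f y (hankelTransform α f y)) :
    AEStronglyMeasurable (hankelTransform α f) (volume.restrict (Ioi (0 : ℝ))) := by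
  have h1 : Tendsto (fun n : ℕ => 1 / ((n : ℝ) + 1)) atTop (𝓝[>] 0) :=
    tendsto_nhdsWithin_iff.2 ⟨tendsto_one_div_add_atTop_nhds_zero_nat,
      Eventually.of_forall fun n => mem_Ioi.2 Nat.one_div_pos_of_nat⟩
  have h2 : Tendsto (fun n : ℕ => (n : ℝ) + 1) atTop atTop :=
    tendsto_atTop_add_const_right _ _ tendsto_natCast_atTop_atTop
  refine aestronglyMeasurable_of_tendsto_ae atTop
    (f := fun (n : ℕ) y => truncHankel α f y (1 / ((n : ℝ) + 1)) ((n : ℝ) + 1)) (fun n => ?_) ?_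
  · have hn : (1 : ℝ) ≤ n + 1 := by simp
    exact aestronglyMeasurable_integral_mul_comp_mul (continuousOn_sqrt_mul_besselJ hα) hf
      (by positivity) (((div_le_one (by positivity)).2 hn).trans hn)
  · filter_upwards [ae_restrict_mem measurableSet_Ioi] with y hy
    exact (hlim y hy).comp (h1.prodMk h2)

theorem mainTheorem7 (α : ℝ) (hα : -1 / 2 ≤ α) (p : ℝ) (hp : 1 < p) (q : ℝ≥0∞) (hq : 1 ≤ q)
    (C lam : ℝ) (hC : 0 < C) (hlam : 1 < lam) :
    ∃ K : ℝ≥0, ∀ f : ℝ → ℂ, IsGeneralMonotone C lam f → MemLorentz p q f →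
      (∀ y : ℝ, 0 < y → HasHankelTransform α f y (hankelTransform α f y)) ∧
      MemLorentz (Real.conjExponent p) q (hankelTransform α f) ∧
      lorentzNorm (Real.conjExponent p) q (hankelTransform α f) ≤ K * lorentzNorm p q f := by
  obtain ⟨c, hc⟩ := exists_hasHankelTransform_le hα C hlam
  have hκ := lintegral_hardyWeight_lt_top (by positivity : 0 < 1 / p)
    ((div_lt_one (by linarith)).2 hp)
  refine ⟨c * (∫⁻ s in Ioi (0 : ℝ), hardyWeight (1 / p) s).toNNReal, fun f hf hfp => ?_⟩
  have hle := hardySum_enorm_le hfp.1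
  have hex := hc f hf hfp.1 fun x =>
    ne_top_of_le_ne_top (hardySum_decreasingRearrangement_ne_top hp hq hfp.2 x) (hle x)
  have hH : ∀ y : ℝ, 0 < y → HasHankelTransform α f y (hankelTransform α f y) ∧
      ‖hankelTransform α f y‖ₑ ≤ c * hardySum (decreasingRearrangement f) (1 / y) := fun y hy => by
    obtain ⟨l, hl, hb⟩ := hex y hy
    have hlim : hankelTransform α f y = l := Tendsto.limUnder_eq hl
    rw [hlim]
    exact ⟨hl, hb.trans (by gcongr; exact hle _)⟩
  have hnorm := lorentzNorm_conjExponent_le hp hq (c := c) ENNReal.coe_ne_top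
    fun y hy => (hH y hy).2
  rw [← ENNReal.coe_toNNReal hκ.ne, ← ENNReal.coe_mul] at hnorm
  exact ⟨fun y hy => (hH y hy).1,
    ⟨aestronglyMeasurable_hankelTransform (by linarith) hfp.1 fun y hy => (hH y hy).1,
      hnorm.trans_lt (ENNReal.mul_lt_top ENNReal.coe_lt_top hfp.2)⟩, hnorm⟩
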